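/- \textbf{Definitions.} For $u\in\mathbb{Z}_{2^s}$ with binary expansion $u=\sum_{i=0}^{s-1}u_i2^i$, $u_i\in\{0,1\}$, Carlet's Gray map is $\phi_s(u)=(u_{s-1},\dots,u_{s-1})+(u_0,\dots,u_{s-2})Y_{s-1}\in\mathbb{Z}_2^{2^{s-1}}$, where the columns of $Y_{s-1}$ are all the vectors of $\mathbb{Z}_2^{s-1}$, ordered as the binary expansions of $0,1,\dots,2^{s-1}-1$; $\Phi_s$ is its componentwise extension to $\mathbb{Z}_{2^s}^n$. Put $\Phi(u_1\mid u_2\mid u_3)=(u_1,\Phi_2(u_2),\Phi_3(u_3))$ on $\mathbb{Z}_2^{\alpha_1}\times\mathbb{Z}_4^{\alpha_2}\times\mathbb{Z}_8^{\alpha_3}$ (with values in $\mathbb{Z}_2^{\alpha_1+2\alpha_2+4\alpha_3}$). A binary Hadamard code of length $n$ is a subset of $\mathbb{Z}_2^n$ with $2n$ elements and minimum Hamming distance $n/2$. A $\mathbb{Z}_2\mathbb{Z}_4$-linear (respectively $\mathbb{Z}_4$-linear, $\mathbb{Z}_8$-linear) Hadamard code of length $N$ is a binary Hadamard code that is the Gray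 image of a subgroup of some $\mathbb{Z}_2^{\alpha_1}\times\mathbb{Z}_4^{\alpha_2}$ with $\alpha_1+2\alpha_2=N$ (respectively of $\mathbb{Z}_4^{n}$ with $2n=N$, of $\mathbb{Z}_8^{n}$ with $4n=N$). Binary codes $C_1,C_2$ of length $n$ are equivalent if $C_2=\{\mathbf a+\pi(\mathbf c):\mathbf c\in C_1\}$ for some $\mathbf a\in\mathbb{Z}_2^n$ and some permutation $\pi$ of the coordinates. For integers $t_1\ge 1$, $t_2\ge 0$, $t_3\ge 1$ let $A^{t_1,t_2,t_3}=(A_1\mid A_2\mid A_3)$ be the matrix with $t_1+t_2+t_3$ rows and blocks of columns over $\mathbb{Z}_2$, $\mathbb{Z}_4$, $\mathbb{Z}_8$ that is obtained as follows (here $\mathbf x$ is a constant row). Start with $$A^{1,0,1}=\left(\begin{array}{cc|c|c}1&1&2&4\\0&1&1&1\end{array}\right).$$ Replace $t_1-1$ times the current matrix $(A_1\mid A_2\mid A_3)$, with $r$ rows, by $$\left(\begin{array}{cc|ccccc|cccc}A_1&A_1&M_1&A_2&A_2&A_2&A_2&M_2&A_3&\cdots&A_3\\ \mathbf 0&\mathbf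 1&\mathbf 1&\mathbf 0&\mathbf 1&\mathbf 2&\mathbf 3&\mathbf 1&\mathbf 0&\cdots&\mathbf 7\end{array}\right),$$ then $t_2$ times by $$\left(\begin{array}{cc|ccccc|cccc}A_1&A_1&M_1&A_2&A_2&A_2&A_2&A_3&A_3&A_3&A_3\\ \mathbf 0&\mathbf 1&\mathbf 1&\mathbf 0&\mathbf 1&\mathbf 2&\mathbf 3&\mathbf 0&\mathbf 2&\mathbf 4&\mathbf 6\end{array}\right),$$ where the columns of $M_1$ are the vectors of $\{2\}\times\{0,2\}^{r-1}$ and those of $M_2$ the vectors of $\{4\}\times\{0,2,4,6\}^{r-1}$, and finally $t_3-1$ times by $$\left(\begin{array}{cc|cc|cc}A_1&A_1&A_2&A_2&A_3&A_3\\ \mathbf 0&\mathbf 1&\mathbf 0&\mathbf 2&\mathbf 0&\mathbf 4\end{array}\right).$$ Let $H^{t_1,t_2,t_3}=\Phi(\mathcal H^{t_1,t_2,t_3})$, where $\mathcal H^{t_1,t_2,t_3}$ is the additive group generated by the rows of $A^{t_1,t_2,t_3}$. \textbf{Theorem.} Let $m\ge 2$ and $t=3m$. Then $H^{t/3,0,1}=H^{m,0,1}$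 is a binary Hadamard code of length $2^t$. It is not equivalent to any code $H^{t_1,t_2,t_3}$ of length $2^t$ with $t_1\ge1$, $t_2\ge 0$, $t_3\ge1$ and $(t_1,t_2,t_3)\ne(m,0,1)$, nor to any $\mathbb{Z}_2\mathbb{Z}_4$-linear, $\mathbb{Z}_4$-linear or $\mathbb{Z}_8$-linear Hadamard code of length $2^t$. -/

import Mathlib

/-- The `i`-th binary digit of `u`, as an element of `ZMod 2`. -/
def binDigit (u i : ℕ) : ZMod 2 := if u.testBit i then 1 else 0

/-- Carlet's Gray map `φ_s : ℤ/2^s → (ℤ/2)^(2^(s-1))`, for the representative `u ∈ {0, …, 2^s - 1}`: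
`φ_s(u) = (u_{s-1}, …, u_{s-1}) + (u_0, …, u_{s-2}) Y`, where column `j` of `Y`
is the binary expansion of `j`. -/
def carletGray (s u : ℕ) (j : Fin (2 ^ (s - 1))) : ZMod 2 :=
  binDigit u (s - 1) + ∑ i ∈ Finset.range (s - 1), binDigit u i * binDigit j.val i

/-- The group `ℤ₂^{α₁} × ℤ₄^{α₂} × ℤ₈^{α₃}`. -/
abbrev MixedSpace (α₁ α₂ α₃ : ℕ) : Type :=
  (Fin α₁ → ZMod 2) × (Fin α₂ → ZMod 4) × (Fin α₃ → ZMod 8)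

/-- The coordinates of the Gray image of `MixedSpace α₁ α₂ α₃`;
there are `α₁ + 2 α₂ + 4 α₃` of them. -/
abbrev MixedCoord (α₁ α₂ α₃ : ℕ) : Type :=
  Fin α₁ ⊕ (Fin α₂ × Fin (2 ^ (2 - 1))) ⊕ (Fin α₃ × Fin (2 ^ (3 - 1)))

/-- The Gray map `Φ(u₁ | u₂ | u₃) = (u₁, Φ₂(u₂), Φ₃(u₃))`. -/
def mixedGray {α₁ α₂ α₃ : ℕ} (u : MixedSpace α₁ α₂ α₃) : MixedCoord α₁ α₂ α₃ → ZMod 2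
  | .inl i => u.1 i
  | .inr (.inl (i, j)) => carletGray 2 (u.2.1 i).val j
  | .inr (.inr (i, j)) => carletGray 3 (u.2.2 i).val j

/-- The Gray map `Φ₂` together with the identity on the binary part. -/
def gray24 {α₁ α₂ : ℕ} (u : (Fin α₁ → ZMod 2) × (Fin α₂ → ZMod 4)) :
    Fin α₁ ⊕ (Fin α₂ × Fin (2 ^ (2 - 1))) → ZMod 2
  | .inl i => u.1 i
  | .inr (i, j) => carletGray 2 (u.2 i).val j

/-- The componentwise Gray map `Φ₂` on `ℤ₄^n`. -/
def gray4 {n : ℕ} (u : Fin n → ZMod 4) : Fin n × Fin (2 ^ (2 - 1)) → ZMod 2 :=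
  fun p => carletGray 2 (u p.1).val p.2

/-- The componentwise Gray map `Φ₃` on `ℤ₈^n`. -/
def gray8 {n : ℕ} (u : Fin n → ZMod 8) : Fin n × Fin (2 ^ (3 - 1)) → ZMod 2 :=
  fun p => carletGray 3 (u p.1).val p.2

/-- A binary Hadamard code: a code of length `n` with `2n` codewords and minimum distance `n/2`.
The length is the number of elements of the finite set `ι` of coordinates. -/
def IsHadamardCode {ι : Type} [Fintype ι] (C : Set (ι → ZMod 2)) : Prop :=
  C.ncard = 2 * Fintype.card ι ∧
    ∃ d : ℕ, IsLeast {k | ∃ u ∈ C, ∃ v ∈ C, u ≠ v ∧ k = hammingDist u v} d ∧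
      2 * d = Fintype.card ι

/-- Two binary codes are equivalent if `C₂ = {a + π(c) : c ∈ C₁}` for a vector `a` and
a permutation (bijection) `π` of the coordinates. -/
def CodeEquivalent {ι κ : Type} (C₁ : Set (ι → ZMod 2)) (C₂ : Set (κ → ZMod 2)) : Prop :=
  ∃ (a : κ → ZMod 2) (π : ι ≃ κ), C₂ = (fun c : ι → ZMod 2 => a + c ∘ π.symm) '' C₁

/-- A matrix `(A₁ | A₂ | A₃)` with `r` rows, given by the lists of its columns over
`ZMod 2`, `ZMod 4` and `ZMod 8`. -/
structure MixedMatrix (r : ℕ) where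
  cols₁ : List (Fin r → ZMod 2)
  cols₂ : List (Fin r → ZMod 4)
  cols₃ : List (Fin r → ZMod 8)

/-- The matrix obtained from the columns `L` by appending a last row that is constantly `x`. -/
def appendRow {r : ℕ} {R : Type} (x : R) (L : List (Fin r → R)) : List (Fin (r + 1) → R) :=
  L.map fun c => Fin.snoc (α := fun _ => R) c x

/-- The columns `z ∈ {2} × {0, 2}^{r-1}` over `ZMod 4`. -/
noncomputable def newCols₄ (r : ℕ) : List (Fin r → ZMod 4) :=
  (Fintype.piFinset fun i : Fin r =>
    if i.val = 0 then ({2} : Finset (ZMod 4)) else {0, 2}).toList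

/-- The columns `z ∈ {4} × {0, 2, 4, 6}^{r-1}` over `ZMod 8`. -/
noncomputable def newCols₈ (r : ℕ) : List (Fin r → ZMod 8) :=
  (Fintype.piFinset fun i : Fin r =>
    if i.val = 0 then ({4} : Finset (ZMod 8)) else {0, 2, 4, 6}).toList

/-- The matrix `A^{1,0,1}`, with rows `(1 1 | 2 | 4)` and `(0 1 | 1 | 1)`. -/
def baseMatrix : MixedMatrix 2 where
  cols₁ := [![1, 0], ![1, 1]]
  cols₂ := [![2, 1]]
  cols₃ := [![4, 1]]

/-- Adding a row of order 8:
`(A₁ A₁ | M₁ A₂ A₂ A₂ A₂ | M₂ A₃ … A₃)` over `(0 1 | 1 0 1 2 3 | 1 0 1 … 7)`. -/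
noncomputable def addRow₈ {r : ℕ} (A : MixedMatrix r) : MixedMatrix (r + 1) where
  cols₁ := appendRow 0 A.cols₁ ++ appendRow 1 A.cols₁
  cols₂ := appendRow 1 (newCols₄ r) ++ [0, 1, 2, 3].flatMap fun x => appendRow x A.cols₂
  cols₃ := appendRow 1 (newCols₈ r) ++
    [0, 1, 2, 3, 4, 5, 6, 7].flatMap fun x => appendRow x A.cols₃

/-- Adding a row of order 4:
`(A₁ A₁ | M₁ A₂ A₂ A₂ A₂ | A₃ A₃ A₃ A₃)` over `(0 1 | 1 0 1 2 3 | 0 2 4 6)`. -/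
noncomputable def addRow₄ {r : ℕ} (A : MixedMatrix r) : MixedMatrix (r + 1) where
  cols₁ := appendRow 0 A.cols₁ ++ appendRow 1 A.cols₁
  cols₂ := appendRow 1 (newCols₄ r) ++ [0, 1, 2, 3].flatMap fun x => appendRow x A.cols₂
  cols₃ := [0, 2, 4, 6].flatMap fun x => appendRow x A.cols₃

/-- Adding a row of order 2:
`(A₁ A₁ | A₂ A₂ | A₃ A₃)` over `(0 1 | 0 2 | 0 4)`. -/
def addRow₂ {r : ℕ} (A : MixedMatrix r) : MixedMatrix (r + 1) where
  cols₁ := appendRow 0 A.cols₁ ++ appendRow 1 A.cols₁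
  cols₂ := appendRow 0 A.cols₂ ++ appendRow 2 A.cols₂
  cols₃ := appendRow 0 A.cols₃ ++ appendRow 4 A.cols₃

/-- `A^{a+1,0,1}`. -/
noncomputable def genMatrix₈ : (a : ℕ) → MixedMatrix (a + 2)
  | 0 => baseMatrix
  | a + 1 => addRow₈ (genMatrix₈ a)

/-- `A^{a+1,b,1}`. -/
noncomputable def genMatrix₄ (a : ℕ) : (b : ℕ) → MixedMatrix (a + 2 + b)
  | 0 => genMatrix₈ a
  | b + 1 => addRow₄ (genMatrix₄ a b)

/-- `A^{a+1,b,c+1}`. -/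
noncomputable def genMatrix₂ (a b : ℕ) : (c : ℕ) → MixedMatrix (a + 2 + b + c)
  | 0 => genMatrix₄ a b
  | c + 1 => addRow₂ (genMatrix₂ a b c)

/-- The generator matrix `A^{t₁,t₂,t₃}`, meaningful for `t₁ ≥ 1` and `t₃ ≥ 1`. -/
noncomputable def genMatrix (t₁ t₂ t₃ : ℕ) : MixedMatrix (t₁ - 1 + 2 + t₂ + (t₃ - 1)) :=
  genMatrix₂ (t₁ - 1) t₂ (t₃ - 1)

namespace MixedMatrix

variable {r : ℕ} (A : MixedMatrix r)

/-- The ambient group of the rows of `A`. -/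
abbrev Space : Type := MixedSpace A.cols₁.length A.cols₂.length A.cols₃.length

/-- The set of coordinates of the Gray images of the rows of `A`. -/
abbrev Coord : Type := MixedCoord A.cols₁.length A.cols₂.length A.cols₃.length

/-- The `i`-th row of `A`. -/
def row (i : Fin r) : A.Space :=
  (fun j => A.cols₁.get j i, fun j => A.cols₂.get j i, fun j => A.cols₃.get j i)

/-- The additive code generated by the rows of `A`. -/
def additiveCode : AddSubgroup A.Space := AddSubgroup.closure (Set.range A.row)

end MixedMatrix

/-- The set of coordinates of the binary code `H^{t₁,t₂,t₃}`. -/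
abbrev HCoord (t₁ t₂ t₃ : ℕ) : Type := (genMatrix t₁ t₂ t₃).Coord

/-- The `ℤ₂ℤ₄ℤ₈`-linear code `H^{t₁,t₂,t₃}`: the Gray image of the `ℤ₂ℤ₄ℤ₈`-additive code
generated by `A^{t₁,t₂,t₃}`. -/
def HCode (t₁ t₂ t₃ : ℕ) : Set (HCoord t₁ t₂ t₃ → ZMod 2) :=
  mixedGray '' ((genMatrix t₁ t₂ t₃).additiveCode : Set (genMatrix t₁ t₂ t₃).Space)

/-!
Write `Φ` for the Gray map, `𝒢` for the additive code generated by `A^{m,0,1}`, and `H` for its Gray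
image. Carlet's Gray map is not additive, but it is affine in the binary digits, so sums of
codewords in `ℤ₂^n` can be computed from the digits of sums in `ℤ₈`.

*`H` is a Hadamard code.* Twice the distance of `Φ(u)` and `Φ(v)` is the length minus the sum of
the signs `(-1)^{Φ(u - v)_j}`. For `u - v = ∑ kᵢ rowᵢ` this sum satisfies a recursion along the
construction of the matrix. Over the first one, two, three blocks of columns it equals, up to sign,
the sum of a character of `ℤ₂^m`, `ℤ₄^m`, `ℤ₈^m` (`corrSum_genMatrix₈`), and so it vanishes unless
`u - v` is a multiple of the first row, whose Gray image is the all-ones word.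

*The kernel of `H`.* As a group, `𝒢` is `ℤ₂ × ℤ₈^m`, and certain coordinates (`Frame`, provided by
`nonempty_frame`) carry the parameters of a word, their pairwise sums `νᵢ + νⱼ` and `νⱼ + 2 νᵢ`,
and reductions of these modulo `4`. If four codewords sum to zero, the carries at these
coordinates give quadratic equations between the digits of the parameters. Since `m ≥ 2`, they imply
that the kernel, the set of `x` with `x + H = H`, consists of the `2^{m+1}` images of words of order
at most two (`Frame.codeKernel_eq`).

*Counting.* In every group code under consideration the elements of order at most two give
kernel elements. For a code equivalent to `H` their number `k` is thus at most `2^{m+1}`, while the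
code has `2^{3m+1}` elements. A code of exponent `4` has at most `k^2` elements, which is too
few. For `H^{t₁,t₂,t₃}` the number of elements is at most `k · 4^{t₁} · 2^{t₂}`; together with
the length `8^{t₁} · 4^{t₂} · 2^{t₃-1}` this forces `(t₁,t₂,t₃) = (m,0,1)`.

*`ℤ₈`-linear codes.* Let `C ≤ ℤ₈^n` have an image equivalent to `H`. Counting correlations over
subgroups of `C` shows that the constant word `4` is `4 w` for some `w ∈ C`
(`exists_four_nsmul_eq`). Then `Φ(y) + Φ(3y + 2w) + Φ(2w) = Φ(4y) (Φ(2y) + 1)` for all `y ∈ C`.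
In `H` such a relation, with `Φ(4y)` in the kernel, is trivial (`Frame.trivial_of_relation`), so
`4y` is the constant word `0` or `4`. Hence at least half of the `y ∈ C` satisfy `4y = 0`, and for
these `Φ(y) + Φ(2w)` is again in the code. But in `H` fewer than half of the codewords `q` have the
property that `h + p + q ∈ H`, if `h, p ∈ H` and `h + p` is not in the kernel
(`Frame.two_mul_ncard_add_mem_lt`), and `Φ(2w)` is not in the kernel since `4w ≠ 0`.
-/

/-! ### Binary digits of residues and the Gray map -/

/-- The `i`-th binary digit of the representative of `u` in `{0, …, n - 1}`. -/
def zbit {n : ℕ} (i : ℕ) (u : ZMod n) : ZMod 2 := binDigit u.val i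

/-- The embedding `ZMod 2 → ZMod 8` onto `{0, 4}`. -/
def quad (e : ZMod 2) : ZMod 8 := 4 * (e.val : ZMod 8)

lemma zbit_zero_add (u v : ZMod 8) : zbit 0 (u + v) = zbit 0 u + zbit 0 v := by
  revert u v; decide

lemma zbit_one_add (u v : ZMod 8) :
    zbit 1 (u + v) = zbit 1 u + zbit 1 v + zbit 0 u * zbit 0 v := by
  revert u v; decide

lemma zbit_two_add (u v : ZMod 8) :
    zbit 2 (u + v) = zbit 2 u + zbit 2 v + zbit 1 u * zbit 1 v +
      zbit 0 u * zbit 0 v * (zbit 1 u + zbit 1 v) := by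
  revert u v; decide

lemma zbit_zero_quad (e : ZMod 2) : zbit 0 (quad e) = 0 := by revert e; decide
lemma zbit_one_quad (e : ZMod 2) : zbit 1 (quad e) = 0 := by revert e; decide
lemma zbit_two_quad (e : ZMod 2) : zbit 2 (quad e) = e := by revert e; decide
lemma zbit_zero_two_mul (u : ZMod 8) : zbit 0 (2 * u) = 0 := by revert u; decide
lemma zbit_one_two_mul (u : ZMod 8) : zbit 1 (2 * u) = zbit 0 u := by revert u; decide
lemma zbit_two_two_mul (u : ZMod 8) : zbit 2 (2 * u) = zbit 1 u := by revert u; decide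

lemma zbit_zero_add_quad (u : ZMod 8) (e : ZMod 2) : zbit 0 (u + quad e) = zbit 0 u := by
  rw [zbit_zero_add, zbit_zero_quad, add_zero]

lemma zbit_one_add_quad (u : ZMod 8) (e : ZMod 2) : zbit 1 (u + quad e) = zbit 1 u := by
  rw [zbit_one_add, zbit_zero_quad, zbit_one_quad, mul_zero, add_zero, add_zero]

lemma zbit_two_add_quad (u : ZMod 8) (e : ZMod 2) : zbit 2 (u + quad e) = zbit 2 u + e := by
  simp [zbit_two_add, zbit_zero_quad, zbit_one_quad, zbit_two_quad]

/-- A residue modulo `8` is determined modulo `4` by its two lower digits. -/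
lemma two_mul_sub_eq_zero_of_zbit {u v : ZMod 8} (h0 : zbit 0 u = zbit 0 v)
    (h1 : zbit 1 u = zbit 1 v) : 2 * (u - v) = 0 := by
  revert u v; decide

lemma eq_quad_of_two_mul {u : ZMod 8} (h : 2 * u = 0) : u = quad (zbit 2 u) := by
  revert u; decide

lemma carletGray_three (u : ZMod 8) (j : Fin (2 ^ (3 - 1))) :
    carletGray 3 u.val j =
      zbit 2 u + zbit 0 u * binDigit j.val 0 + zbit 1 u * binDigit j.val 1 := by
  simp [carletGray, Finset.sum_range_succ, zbit, add_assoc]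

lemma carletGray_two (u : ZMod 4) (j : Fin (2 ^ (2 - 1))) :
    carletGray 2 u.val j = zbit 1 u + zbit 0 u * binDigit j.val 0 := by
  simp [carletGray, zbit]

lemma carletGray_three_add (u v : ZMod 8) (h : 2 * u = 0) (j : Fin (2 ^ (3 - 1))) :
    carletGray 3 u.val j + carletGray 3 v.val j = carletGray 3 (u + v).val j := by
  obtain ⟨e, rfl⟩ : ∃ e, u = quad e := ⟨_, eq_quad_of_two_mul h⟩
  rw [add_comm (quad e) v]
  simp only [carletGray_three, zbit_zero_add_quad, zbit_one_add_quad, zbit_two_add_quad,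
    zbit_zero_quad, zbit_one_quad, zbit_two_quad]
  ring

lemma carletGray_two_add (u v : ZMod 4) (h : 2 * u = 0) (j : Fin (2 ^ (2 - 1))) :
    carletGray 2 u.val j + carletGray 2 v.val j = carletGray 2 (u + v).val j := by
  revert u v j; decide

lemma carletGray_three_injective {u v : ZMod 8}
    (h : ∀ j, carletGray 3 u.val j = carletGray 3 v.val j) : u = v := by
  revert u v; decide

lemma carletGray_two_injective {u v : ZMod 4}
    (h : ∀ j, carletGray 2 u.val j = carletGray 2 v.val j) : u = v := by
  revert u v; decide

/-- The three-term relation satisfied by every `ℤ₈`-linear code that contains a word `w` all of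
whose entries are odd. -/
lemma carletGray_three_odd_relation (y w : ZMod 8) (hw : 4 * w = 4) (j : Fin (2 ^ (3 - 1))) :
    carletGray 3 y.val j + carletGray 3 (3 * y + 2 * w).val j + carletGray 3 (2 * w).val j =
      carletGray 3 (4 * y).val j * (carletGray 3 (2 * y).val j + 1) := by
  revert y w j; decide

/-! ### Correlations and Hamming distances -/

/-- The sign `(-1) ^ u`. -/
def corr₂ (u : ZMod 2) : ℤ := if u = 0 then 1 else -1

/-- The sum of the signs `(-1) ^ φ₂(u)_j`. -/
def corr₄ (u : ZMod 4) : ℤ := if u = 0 then 2 else if u = 2 then -2 else 0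

/-- The sum of the signs `(-1) ^ φ₃(u)_j`. -/
def corr₈ (u : ZMod 8) : ℤ := if u = 0 then 4 else if u = 4 then -4 else 0

/-- The sum of the signs `(-1) ^ Φ(u)_j` over all binary coordinates `j`. -/
def mixedCorr {α₁ α₂ α₃ : ℕ} (u : MixedSpace α₁ α₂ α₃) : ℤ :=
  ∑ i, corr₂ (u.1 i) + ∑ i, corr₄ (u.2.1 i) + ∑ i, corr₈ (u.2.2 i)

lemma two_mul_dist_two (u v : ZMod 2) :
    2 * (if u ≠ v then 1 else 0 : ℤ) = 1 - corr₂ (u - v) := by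
  revert u v; decide

lemma two_mul_dist_four (u v : ZMod 4) :
    2 * ∑ j, (if carletGray 2 u.val j ≠ carletGray 2 v.val j then 1 else 0 : ℤ) =
      2 - corr₄ (u - v) := by
  revert u v; decide

lemma two_mul_dist_eight (u v : ZMod 8) :
    2 * ∑ j, (if carletGray 3 u.val j ≠ carletGray 3 v.val j then 1 else 0 : ℤ) =
      4 - corr₈ (u - v) := by
  revert u v; decide

lemma card_mixedCoord (α₁ α₂ α₃ : ℕ) :
    Fintype.card (MixedCoord α₁ α₂ α₃) = α₁ + 2 * α₂ + 4 * α₃ := by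
  simp only [MixedCoord, Fintype.card_sum, Fintype.card_prod, Fintype.card_fin]
  norm_num; ring

/-- Carlet's Gray map turns differences into distances. -/
lemma two_mul_hammingDist_mixedGray {α₁ α₂ α₃ : ℕ} (u v : MixedSpace α₁ α₂ α₃) :
    2 * (hammingDist (mixedGray u) (mixedGray v) : ℤ) =
      Fintype.card (MixedCoord α₁ α₂ α₃) - mixedCorr (u - v) := by
  have h₂ : 2 * ∑ i, (if u.1 i ≠ v.1 i then 1 else 0 : ℤ) =
      ∑ i, (1 - corr₂ (u.1 i - v.1 i)) := by
    rw [Finset.mul_sum]; exact Finset.sum_congr rfl fun i _ => two_mul_dist_two _ _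
  have h₄ : 2 * ∑ i, ∑ j, (if carletGray 2 (u.2.1 i).val j ≠ carletGray 2 (v.2.1 i).val j
      then 1 else 0 : ℤ) = ∑ i, (2 - corr₄ (u.2.1 i - v.2.1 i)) := by
    rw [Finset.mul_sum]; exact Finset.sum_congr rfl fun i _ => two_mul_dist_four _ _
  have h₈ : 2 * ∑ i, ∑ j, (if carletGray 3 (u.2.2 i).val j ≠ carletGray 3 (v.2.2 i).val j
      then 1 else 0 : ℤ) = ∑ i, (4 - corr₈ (u.2.2 i - v.2.2 i)) := by
    rw [Finset.mul_sum]; exact Finset.sum_congr rfl fun i _ => two_mul_dist_eight _ _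
  rw [card_mixedCoord, hammingDist, Finset.card_filter]
  push_cast
  rw [Fintype.sum_sum_type, Fintype.sum_sum_type, Fintype.sum_prod_type, Fintype.sum_prod_type,
    mul_add, mul_add]
  refine (congrArg₂ _ h₂ (congrArg₂ _ h₄ h₈)).trans ?_
  simp only [Finset.sum_sub_distrib, mixedCorr, Finset.sum_const, Finset.card_univ,
    Fintype.card_fin, nsmul_eq_mul, Prod.fst_sub, Prod.snd_sub, Pi.sub_apply]
  ring

lemma two_mul_hammingDist_gray8 {n : ℕ} (u v : Fin n → ZMod 8) :
    2 * (hammingDist (gray8 u) (gray8 v) : ℤ) = 4 * n - ∑ i, corr₈ (u i - v i) := by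
  have h₈ : 2 * ∑ i, ∑ j, (if carletGray 3 (u i).val j ≠ carletGray 3 (v i).val j
      then 1 else 0 : ℤ) = ∑ i, (4 - corr₈ (u i - v i)) := by
    rw [Finset.mul_sum]; exact Finset.sum_congr rfl fun i _ => two_mul_dist_eight _ _
  rw [hammingDist, Finset.card_filter]
  push_cast
  rw [Fintype.sum_prod_type]
  refine h₈.trans ?_
  simp only [Finset.sum_sub_distrib, Finset.sum_const, Finset.card_univ,
    Fintype.card_fin, nsmul_eq_mul]
  ring

lemma mixedGray_injective {α₁ α₂ α₃ : ℕ} :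
    Function.Injective (mixedGray : MixedSpace α₁ α₂ α₃ → _) := by
  intro u v h
  refine Prod.ext (funext fun i => congrFun h (.inl i)) (Prod.ext (funext fun i => ?_)
    (funext fun i => ?_))
  · exact carletGray_two_injective fun j => congrFun h (.inr (.inl (i, j)))
  · exact carletGray_three_injective fun j => congrFun h (.inr (.inr (i, j)))

lemma gray24_injective {α₁ α₂ : ℕ} :
    Function.Injective (gray24 : (Fin α₁ → ZMod 2) × (Fin α₂ → ZMod 4) → _) := by
  intro u v h
  refine Prod.ext (funext fun i => congrFun h (.inl i)) (funext fun i => ?_)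
  exact carletGray_two_injective fun j => congrFun h (.inr (i, j))

lemma gray4_injective {n : ℕ} : Function.Injective (gray4 : (Fin n → ZMod 4) → _) :=
  fun _ _ h => funext fun i => carletGray_two_injective fun j => congrFun h (i, j)

lemma gray8_injective {n : ℕ} : Function.Injective (gray8 : (Fin n → ZMod 8) → _) :=
  fun _ _ h => funext fun i => carletGray_three_injective fun j => congrFun h (i, j)

/-- Translation by a word of order at most two is compatible with the Gray map, because such a word
changes only the top digits. -/
lemma mixedGray_add {α₁ α₂ α₃ : ℕ} (u v : MixedSpace α₁ α₂ α₃) (h : 2 • u = 0) :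
    mixedGray u + mixedGray v = mixedGray (u + v) := by
  funext p
  rcases p with i | ⟨i, j⟩ | ⟨i, j⟩
  · rfl
  · refine carletGray_two_add _ _ ?_ j
    simpa [nsmul_eq_mul] using congrFun (congrArg (fun u => u.2.1) h) i
  · refine carletGray_three_add _ _ ?_ j
    simpa [nsmul_eq_mul] using congrFun (congrArg (fun u => u.2.2) h) i

lemma gray24_add {α₁ α₂ : ℕ} (u v : (Fin α₁ → ZMod 2) × (Fin α₂ → ZMod 4)) (h : 2 • u = 0) :
    gray24 u + gray24 v = gray24 (u + v) := by
  funext p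
  rcases p with i | ⟨i, j⟩
  · rfl
  · refine carletGray_two_add _ _ ?_ j
    simpa [nsmul_eq_mul] using congrFun (congrArg (fun u => u.2) h) i

lemma gray4_add {n : ℕ} (u v : Fin n → ZMod 4) (h : 2 • u = 0) :
    gray4 u + gray4 v = gray4 (u + v) := by
  funext p
  refine carletGray_two_add _ _ ?_ p.2
  simpa [nsmul_eq_mul] using congrFun h p.1

lemma gray8_add {n : ℕ} (u v : Fin n → ZMod 8) (h : 2 • u = 0) :
    gray8 u + gray8 v = gray8 (u + v) := by
  funext p
  refine carletGray_three_add _ _ ?_ p.2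
  simpa [nsmul_eq_mul] using congrFun h p.1

/-! ### Sums of four codewords -/

lemma word_add_self {ι : Type} (x : ι → ZMod 2) : x + x = 0 :=
  funext fun _ => CharTwo.add_self_eq_zero _

/-- If a sum of four values of `φ₃` is constant, then their two lower digits sum to zero. -/
lemma sum_zbit_of_const {a b c d : ZMod 8} {x : ZMod 2}
    (H : ∀ j, carletGray 3 a.val j + carletGray 3 b.val j + carletGray 3 c.val j +
      carletGray 3 d.val j = x) :
    zbit 0 a + zbit 0 b + zbit 0 c + zbit 0 d = 0 ∧
      zbit 1 a + zbit 1 b + zbit 1 c + zbit 1 d = 0 ∧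
      zbit 2 a + zbit 2 b + zbit 2 c + zbit 2 d = x := by
  have h0 := H 0
  have h1 := H 1
  have h2 := H 2
  simp only [carletGray_three] at h0 h1 h2
  have e0 : binDigit (0 : Fin (2 ^ (3 - 1))).val 0 = 0 := by decide
  have e0' : binDigit (0 : Fin (2 ^ (3 - 1))).val 1 = 0 := by decide
  have e1 : binDigit (1 : Fin (2 ^ (3 - 1))).val 0 = 1 := by decide
  have e1' : binDigit (1 : Fin (2 ^ (3 - 1))).val 1 = 0 := by decide
  have e2 : binDigit (2 : Fin (2 ^ (3 - 1))).val 0 = 0 := by decide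
  have e2' : binDigit (2 : Fin (2 ^ (3 - 1))).val 1 = 1 := by decide
  rw [e0, e0'] at h0
  rw [e1, e1'] at h1
  rw [e2, e2'] at h2
  refine ⟨by linear_combination h1 - h0, by linear_combination h2 - h0, by linear_combination h0⟩

lemma sum_zbit_of_const_four {a b c d : ZMod 4} {x : ZMod 2}
    (H : ∀ j, carletGray 2 a.val j + carletGray 2 b.val j + carletGray 2 c.val j +
      carletGray 2 d.val j = x) :
    zbit 0 a + zbit 0 b + zbit 0 c + zbit 0 d = 0 ∧
      zbit 1 a + zbit 1 b + zbit 1 c + zbit 1 d = x := by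
  have h0 := H 0
  have h1 := H 1
  simp only [carletGray_two] at h0 h1
  have e0 : binDigit (0 : Fin (2 ^ (2 - 1))).val 0 = 0 := by decide
  have e1 : binDigit (1 : Fin (2 ^ (2 - 1))).val 0 = 1 := by decide
  rw [e0] at h0
  rw [e1] at h1
  refine ⟨by linear_combination h1 - h0, by linear_combination h0⟩

/-- Coordinates of an additive code `G` that exhibit it as `ℤ₂ × ℤ₈^m`. A word `u` has the
parameters `ε = u.1 o` and `ν i = u.2.2 (e₈ i)`. The coordinates `s₈ i j` and `d₈ i j` carry
`ν i + ν j` (up to `4 ε`) and `ν j + 2 ν i`; the quaternary coordinates `e₄ i` and `s₄ i j`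
carry the reductions modulo `4` of those at `e₈ i` and `s₈ i j`, up to `2 ε`. -/
structure Frame {α₁ α₂ α₃ : ℕ} (m : ℕ) (G : AddSubgroup (MixedSpace α₁ α₂ α₃)) where
  o : Fin α₁
  e₄ : Fin m → Fin α₂
  s₄ : Fin m → Fin m → Fin α₂
  e₈ : Fin m → Fin α₃
  s₈ : Fin m → Fin m → Fin α₃
  d₈ : Fin m → Fin m → Fin α₃
  eight_add : ∀ u ∈ G, ∀ i j, i ≠ j →
    u.2.2 (s₈ i j) = u.2.2 (e₈ i) + u.2.2 (e₈ j) + quad (u.1 o)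
  eight_double : ∀ u ∈ G, ∀ i j, i ≠ j → u.2.2 (d₈ i j) = u.2.2 (e₈ j) + 2 * u.2.2 (e₈ i)
  four_single : ∀ u ∈ G, ∀ i, zbit 0 (u.2.1 (e₄ i)) = zbit 0 (u.2.2 (e₈ i)) ∧
    zbit 1 (u.2.1 (e₄ i)) = zbit 1 (u.2.2 (e₈ i)) + u.1 o
  four_add : ∀ u ∈ G, ∀ i j, i ≠ j → zbit 0 (u.2.1 (s₄ i j)) = zbit 0 (u.2.2 (s₈ i j)) ∧
    zbit 1 (u.2.1 (s₄ i j)) = zbit 1 (u.2.2 (s₈ i j)) + u.1 o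
  eq_zero : ∀ u ∈ G, u.1 o = 0 → (∀ i, u.2.2 (e₈ i) = 0) → u = 0
  exists_word : ∀ (ε : ZMod 2) (ν : Fin m → ZMod 8), ∃ u ∈ G, u.1 o = ε ∧ ∀ i, u.2.2 (e₈ i) = ν i
  gray_ones : ∀ u ∈ G, u.1 o = 1 → (∀ i, u.2.2 (e₈ i) = 4) → mixedGray u = 1

/-- The kernel of a binary code: the vectors that translate it into itself. -/
def codeKernel {ι : Type} (C : Set (ι → ZMod 2)) : Set (ι → ZMod 2) := {x | ∀ c ∈ C, x + c ∈ C}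

namespace Frame

variable {α₁ α₂ α₃ m : ℕ} {G : AddSubgroup (MixedSpace α₁ α₂ α₃)} (F : Frame m G)

/-- The parameters `ν i` of a word. -/
def nu (u : MixedSpace α₁ α₂ α₃) (i : Fin m) : ZMod 8 := u.2.2 (F.e₈ i)

lemma nu_add (u v : MixedSpace α₁ α₂ α₃) (i : Fin m) : F.nu (u + v) i = F.nu u i + F.nu v i := rfl

lemma nu_zero (i : Fin m) : F.nu (0 : MixedSpace α₁ α₂ α₃) i = 0 := rfl

section FourWords

variable {h p q r : MixedSpace α₁ α₂ α₃} (hh : h ∈ G) (hp : p ∈ G) (hq : q ∈ G) (hr : r ∈ G)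
  (H : mixedGray h + mixedGray p + mixedGray q + mixedGray r = 0)

lemma sum_zbit (H : mixedGray h + mixedGray p + mixedGray q + mixedGray r = 0) (c : Fin α₃) :
    zbit 0 (h.2.2 c) + zbit 0 (p.2.2 c) + zbit 0 (q.2.2 c) + zbit 0 (r.2.2 c) = 0 ∧
      zbit 1 (h.2.2 c) + zbit 1 (p.2.2 c) + zbit 1 (q.2.2 c) + zbit 1 (r.2.2 c) = 0 ∧
      zbit 2 (h.2.2 c) + zbit 2 (p.2.2 c) + zbit 2 (q.2.2 c) + zbit 2 (r.2.2 c) = 0 :=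
  sum_zbit_of_const fun j => congrFun H (.inr (.inr (c, j)))

include hh hp hq hr H

/-- The carries from the lowest digit in the sums `ν i + ν j` of four words with sum zero add up to
zero. -/
lemma sum_zbit_zero_mul {i j : Fin m} (hij : i ≠ j) :
    zbit 0 (F.nu h i) * zbit 0 (F.nu h j) + zbit 0 (F.nu p i) * zbit 0 (F.nu p j) +
      zbit 0 (F.nu q i) * zbit 0 (F.nu q j) + zbit 0 (F.nu r i) * zbit 0 (F.nu r j) = 0 := by
  have h1 := (sum_zbit H (F.s₈ i j)).2.1
  rw [F.eight_add h hh i j hij, F.eight_add p hp i j hij, F.eight_add q hq i j hij,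
    F.eight_add r hr i j hij] at h1
  simp only [zbit_one_add_quad] at h1
  simp only [zbit_one_add] at h1
  have h2 := (sum_zbit H (F.e₈ i)).2.1
  have h3 := (sum_zbit H (F.e₈ j)).2.1
  simp only [nu]
  linear_combination h1 - h2 - h3

/-- The carries from the middle digit in the sums `ν j + 2 ν i` of four words with sum zero add up
to zero. -/
lemma sum_zbit_one_mul_zbit_zero {i j : Fin m} (hij : i ≠ j) :
    zbit 1 (F.nu h j) * zbit 0 (F.nu h i) + zbit 1 (F.nu p j) * zbit 0 (F.nu p i) +
      zbit 1 (F.nu q j) * zbit 0 (F.nu q i) + zbit 1 (F.nu r j) * zbit 0 (F.nu r i) = 0 := by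
  have h1 := (sum_zbit H (F.d₈ i j)).2.2
  rw [F.eight_double h hh i j hij, F.eight_double p hp i j hij, F.eight_double q hq i j hij,
    F.eight_double r hr i j hij] at h1
  simp only [zbit_two_add, zbit_zero_two_mul, zbit_one_two_mul, zbit_two_two_mul] at h1
  have h2 := (sum_zbit H (F.e₈ j)).2.2
  have h3 := (sum_zbit H (F.e₈ i)).2.1
  simp only [nu]
  linear_combination h1 - h2 - h3

/-- The carries into the top digit in the sums `ν i + ν j` of four words with sum zero add up to
zero. -/
lemma sum_zbit_one_mul {i j : Fin m} (hij : i ≠ j) :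
    (zbit 1 (F.nu h i) * zbit 1 (F.nu h j) +
        zbit 0 (F.nu h i) * zbit 0 (F.nu h j) * (zbit 1 (F.nu h i) + zbit 1 (F.nu h j))) +
      (zbit 1 (F.nu p i) * zbit 1 (F.nu p j) +
        zbit 0 (F.nu p i) * zbit 0 (F.nu p j) * (zbit 1 (F.nu p i) + zbit 1 (F.nu p j))) +
      (zbit 1 (F.nu q i) * zbit 1 (F.nu q j) +
        zbit 0 (F.nu q i) * zbit 0 (F.nu q j) * (zbit 1 (F.nu q i) + zbit 1 (F.nu q j))) +
      (zbit 1 (F.nu r i) * zbit 1 (F.nu r j) +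
        zbit 0 (F.nu r i) * zbit 0 (F.nu r j) * (zbit 1 (F.nu r i) + zbit 1 (F.nu r j))) = 0 := by
  have h1 := (sum_zbit H (F.s₈ i j)).2.2
  rw [F.eight_add h hh i j hij, F.eight_add p hp i j hij, F.eight_add q hq i j hij,
    F.eight_add r hr i j hij] at h1
  simp only [zbit_two_add_quad] at h1
  simp only [zbit_two_add] at h1
  have h2 := (sum_zbit H (F.e₈ i)).2.2
  have h3 := (sum_zbit H (F.e₈ j)).2.2
  have h4 : h.1 F.o + p.1 F.o + q.1 F.o + r.1 F.o = 0 := congrFun H (.inl F.o)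
  simp only [nu]
  linear_combination h1 - h2 - h3 - h4

/-- Modulo `2`, the parameter vectors of `h + p` and `h + q` are linearly dependent. -/
lemma minor_eq_zero {i j : Fin m} (hij : i ≠ j) :
    (zbit 0 (F.nu h i) + zbit 0 (F.nu p i)) * (zbit 0 (F.nu h j) + zbit 0 (F.nu q j)) +
      (zbit 0 (F.nu h j) + zbit 0 (F.nu p j)) * (zbit 0 (F.nu h i) + zbit 0 (F.nu q i)) = 0 := by
  have key : ∀ a b c d a' b' c' d' : ZMod 2, a + b + c + d = 0 → a' + b' + c' + d' = 0 →
      a * a' + b * b' + c * c' + d * d' = 0 →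
      (a + b) * (a' + c') + (a' + b') * (a + c) = 0 := by decide
  exact key _ _ _ _ _ _ _ _ (sum_zbit H (F.e₈ i)).1 (sum_zbit H (F.e₈ j)).1
    (F.sum_zbit_zero_mul hh hp hq hr H hij)

/-- If four words with sum zero agree modulo `2`, then half the differences `p - h` and `q - h`
have linearly dependent parameter vectors modulo `2`. -/
lemma half_minor_eq_zero {i j : Fin m} (hij : i ≠ j)
    (hp0 : ∀ k, zbit 0 (F.nu p k) = zbit 0 (F.nu h k))
    (hq0 : ∀ k, zbit 0 (F.nu q k) = zbit 0 (F.nu h k)) :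
    (zbit 1 (F.nu h i) + zbit 1 (F.nu p i)) * (zbit 1 (F.nu h j) + zbit 1 (F.nu q j)) +
      (zbit 1 (F.nu h j) + zbit 1 (F.nu p j)) * (zbit 1 (F.nu h i) + zbit 1 (F.nu q i)) = 0 := by
  have hr0 : ∀ k, zbit 0 (F.nu r k) = zbit 0 (F.nu h k) := by
    intro k
    have := (sum_zbit H (F.e₈ k)).1
    have h1 := hp0 k
    have h2 := hq0 k
    simp only [nu] at h1 h2 ⊢
    rw [h1, h2] at this
    revert this
    generalize zbit 0 (h.2.2 (F.e₈ k)) = x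
    generalize zbit 0 (r.2.2 (F.e₈ k)) = y
    revert x y; decide
  have key : ∀ x a b c d a' b' c' d' : ZMod 2, a + b + c + d = 0 → a' + b' + c' + d' = 0 →
      (a * a' + x * (a + a')) + (b * b' + x * (b + b')) + (c * c' + x * (c + c')) +
        (d * d' + x * (d + d')) = 0 →
      (a + b) * (a' + c') + (a' + b') * (a + c) = 0 := by decide
  have h1 := F.sum_zbit_one_mul hh hp hq hr H hij
  simp only [hp0, hq0, hr0] at h1
  exact key _ _ _ _ _ _ _ _ _ (sum_zbit H (F.e₈ i)).2.1 (sum_zbit H (F.e₈ j)).2.1 h1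

end FourWords

include F

lemma two_nsmul_eq_zero {u : MixedSpace α₁ α₂ α₃} (hu : u ∈ G)
    (h : ∀ i, 2 * F.nu u i = 0) : 2 • u = 0 := by
  refine F.eq_zero _ (G.nsmul_mem hu 2) ?_ fun i => ?_
  · have key : ∀ x : ZMod 2, 2 • x = 0 := by decide
    exact key _
  · simpa [nsmul_eq_mul, nu] using h i

/-- The kernel of the Gray image consists of the images of the words of order at most two. -/
lemma exists_of_mem_codeKernel (hm : 2 ≤ m) {x : MixedCoord α₁ α₂ α₃ → ZMod 2}
    (hx : x ∈ codeKernel (mixedGray '' (G : Set (MixedSpace α₁ α₂ α₃)))) :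
    ∃ u ∈ G, 2 • u = 0 ∧ mixedGray u = x := by
  have gray_zero : mixedGray (0 : MixedSpace α₁ α₂ α₃) = 0 := by
    have := mixedGray_add (0 : MixedSpace α₁ α₂ α₃) 0 (by simp)
    simpa using this
  obtain ⟨u, hu, hux⟩ := hx 0 ⟨0, G.zero_mem, gray_zero⟩
  rw [add_zero] at hux
  refine ⟨u, hu, ?_, hux⟩
  have H : ∀ q ∈ G, ∃ r ∈ G,
      mixedGray (0 : MixedSpace α₁ α₂ α₃) + mixedGray u + mixedGray q + mixedGray r = 0 := by
    intro q hq
    obtain ⟨r, hr, hrx⟩ := hx _ ⟨q, hq, rfl⟩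
    refine ⟨r, hr, ?_⟩
    rw [hrx, gray_zero, hux, zero_add]
    exact word_add_self _
  have : Nontrivial (Fin m) := Fin.nontrivial_iff_two_le.2 hm
  have z0 : zbit 0 (0 : ZMod 8) = 0 := by decide
  have z1 : zbit 1 (0 : ZMod 8) = 0 := by decide
  -- The `j`-th unit vector `q` is independent of `u` modulo `2`, if the `i`-th parameter is odd.
  have h0 : ∀ i, zbit 0 (F.nu u i) = 0 := by
    intro i
    obtain ⟨j, hj⟩ := exists_ne i
    obtain ⟨q, hq, -, hqν⟩ := F.exists_word 0 (Pi.single j 1)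
    obtain ⟨r, hr, hH⟩ := H q hq
    have := F.minor_eq_zero G.zero_mem hu hq hr hH hj.symm
    have hqi : F.nu q i = 0 := by rw [nu, hqν, Pi.single_eq_of_ne hj.symm]
    have hqj : F.nu q j = 1 := by rw [nu, hqν, Pi.single_eq_same]
    have o0 : zbit 0 (1 : ZMod 8) = 1 := by decide
    simpa [nu_zero, z0, hqi, hqj, o0] using this
  -- Since `u` is now even, the same argument applies to the halves of `u` and of twice `q`.
  have h1 : ∀ i, zbit 1 (F.nu u i) = 0 := by
    intro i
    obtain ⟨j, hj⟩ := exists_ne i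
    obtain ⟨q, hq, -, hqν⟩ := F.exists_word 0 (Pi.single j 2)
    obtain ⟨r, hr, hH⟩ := H q hq
    have o0 : zbit 0 (2 : ZMod 8) = 0 := by decide
    have o1 : zbit 1 (2 : ZMod 8) = 1 := by decide
    have hqi : F.nu q i = 0 := by rw [nu, hqν, Pi.single_eq_of_ne hj.symm]
    have hqj : F.nu q j = 2 := by rw [nu, hqν, Pi.single_eq_same]
    have := F.half_minor_eq_zero G.zero_mem hu hq hr hH hj.symm
      (fun k => by rw [h0, nu_zero, z0]) (fun k => by
        rw [nu_zero, z0, nu, hqν]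
        by_cases hk : k = j
        · subst hk; rw [Pi.single_eq_same, o0]
        · rw [Pi.single_eq_of_ne hk, z0])
    simpa [nu_zero, z1, hqi, hqj, o1] using this
  refine F.two_nsmul_eq_zero hu fun i => ?_
  have := two_mul_sub_eq_zero_of_zbit ((h0 i).trans z0.symm) ((h1 i).trans z1.symm)
  simpa using this

end Frame

namespace Frame

variable {α₁ α₂ α₃ m : ℕ} {G : AddSubgroup (MixedSpace α₁ α₂ α₃)} (F : Frame m G)

/-- At an octal coordinate `c₈` whose reduction modulo `4` occurs as a quaternary coordinate `c₄`,
the relation `h + p + q + r = κ (h + s + 1)` forces `h` and `s` to agree modulo `4`, unless `κ` has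
the same value there as on the quaternary coordinates. The reason is that on the quaternary
coordinates, where `κ` is constant, the relation says that four words have a constant sum; hence
the lower digits of these words at `c₈` sum to zero. -/
lemma zbit_eq_of_relation {h p q r s κ : MixedSpace α₁ α₂ α₃} (hh : h ∈ G) (hp : p ∈ G)
    (hq : q ∈ G) (hr : r ∈ G) (hs : s ∈ G) (hκ : κ ∈ G) (hκ2 : 2 • κ = 0)
    (H : mixedGray h + mixedGray p + mixedGray q + mixedGray r =
      mixedGray κ * (mixedGray h + mixedGray s + 1)) {c₈ : Fin α₃} {c₄ : Fin α₂}
    (hc : ∀ u ∈ G, zbit 0 (u.2.1 c₄) = zbit 0 (u.2.2 c₈) ∧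
      zbit 1 (u.2.1 c₄) = zbit 1 (u.2.2 c₈) + u.1 F.o)
    (hne : zbit 2 (κ.2.2 c₈) ≠ κ.1 F.o) :
    zbit 0 (h.2.2 c₈) = zbit 0 (s.2.2 c₈) ∧ zbit 1 (h.2.2 c₈) = zbit 1 (s.2.2 c₈) := by
  obtain ⟨b, hb⟩ : ∃ b, κ.2.2 c₈ = quad b := by
    refine ⟨_, eq_quad_of_two_mul ?_⟩
    simpa [nsmul_eq_mul] using congrFun (congrArg (fun u => u.2.2) hκ2) c₈
  rw [hb, zbit_two_quad] at hne
  have k4 := hc κ hκ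
  rw [hb, zbit_zero_quad, zbit_one_quad, zero_add] at k4
  have H1 : h.1 F.o + p.1 F.o + q.1 F.o + r.1 F.o = κ.1 F.o * (h.1 F.o + s.1 F.o + 1) :=
    congrFun H (.inl F.o)
  have H4 : ∀ j, carletGray 2 (h.2.1 c₄).val j + carletGray 2 (p.2.1 c₄).val j +
      carletGray 2 (q.2.1 c₄).val j + carletGray 2 (r.2.1 c₄).val j =
      κ.1 F.o * (carletGray 2 (h.2.1 c₄).val j + carletGray 2 (s.2.1 c₄).val j + 1) := by
    intro j
    have h2 : carletGray 2 (κ.2.1 c₄).val j = κ.1 F.o := by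
      rw [carletGray_two, k4.1, k4.2, zero_mul, add_zero]
    rw [← h2]
    exact congrFun H (.inr (.inl (c₄, j)))
  have H8 : ∀ j, carletGray 3 (h.2.2 c₈).val j + carletGray 3 (p.2.2 c₈).val j +
      carletGray 3 (q.2.2 c₈).val j + carletGray 3 (r.2.2 c₈).val j =
      b * (carletGray 3 (h.2.2 c₈).val j + carletGray 3 (s.2.2 c₈).val j + 1) := by
    intro j
    have h2 : carletGray 3 (κ.2.2 c₈).val j = b := by
      simp [carletGray_three, hb, zbit_zero_quad, zbit_one_quad, zbit_two_quad]
    rw [← h2]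
    exact congrFun H (.inr (.inr (c₈, j)))
  -- It suffices that `φ₃(h) + φ₃(s)` is constant on the block of `c₈`.
  suffices hx : ∃ x, ∀ j, carletGray 3 (h.2.2 c₈).val j + carletGray 3 (s.2.2 c₈).val j = x by
    obtain ⟨x, hx⟩ := hx
    have h0 : ∀ j, carletGray 3 (0 : ZMod 8).val j = 0 := by decide
    have z0 : zbit 0 (0 : ZMod 8) = 0 := by decide
    have z1 : zbit 1 (0 : ZMod 8) = 0 := by decide
    have := sum_zbit_of_const (a := h.2.2 c₈) (b := s.2.2 c₈) (c := 0) (d := 0) (x := x)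
      fun j => by rw [h0, add_zero, add_zero, hx]
    rw [z0, z1, add_zero, add_zero, add_zero, add_zero] at this
    exact ⟨CharTwo.add_eq_zero.1 this.1, CharTwo.add_eq_zero.1 this.2.1⟩
  have const : ∀ {a b c d : MixedSpace α₁ α₂ α₃} {e : ZMod 2}, a ∈ G → b ∈ G → c ∈ G → d ∈ G →
      a.1 F.o + b.1 F.o + c.1 F.o + d.1 F.o = e →
      (∀ j, carletGray 2 (a.2.1 c₄).val j + carletGray 2 (b.2.1 c₄).val j +
        carletGray 2 (c.2.1 c₄).val j + carletGray 2 (d.2.1 c₄).val j = e) →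
      ∃ x, ∀ j, carletGray 3 (a.2.2 c₈).val j + carletGray 3 (b.2.2 c₈).val j +
        carletGray 3 (c.2.2 c₈).val j + carletGray 3 (d.2.2 c₈).val j = x := by
    intro a b c d e ha hb hc' hd ho h4
    obtain ⟨s0, s1⟩ := sum_zbit_of_const_four h4
    rw [(hc a ha).1, (hc b hb).1, (hc c hc').1, (hc d hd).1] at s0
    rw [(hc a ha).2, (hc b hb).2, (hc c hc').2, (hc d hd).2] at s1
    have s1' : zbit 1 (a.2.2 c₈) + zbit 1 (b.2.2 c₈) + zbit 1 (c.2.2 c₈) + zbit 1 (d.2.2 c₈) =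
        0 := by linear_combination s1 - ho
    refine ⟨zbit 2 (a.2.2 c₈) + zbit 2 (b.2.2 c₈) + zbit 2 (c.2.2 c₈) + zbit 2 (d.2.2 c₈),
      fun j => ?_⟩
    simp only [carletGray_three]
    linear_combination binDigit j.val 0 * s0 + binDigit j.val 1 * s1'
  have two : (2 : ZMod 2) = 0 := by decide
  generalize κ.1 F.o = ε at *
  obtain ⟨rfl, rfl⟩ | ⟨rfl, rfl⟩ : (ε = 0 ∧ b = 1) ∨ (ε = 1 ∧ b = 0) := by
    clear H1 H4 H8 hb k4
    revert ε b; decide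
  · obtain ⟨x, hx⟩ := const hh hp hq hr (e := 0) (by rw [H1, zero_mul])
      (fun j => by rw [H4, zero_mul])
    exact ⟨x + 1, fun j => by linear_combination hx j - H8 j - two⟩
  · obtain ⟨x, hx⟩ := const hp hq hr hs (e := 1) (by linear_combination H1 + s.1 F.o * two)
      (fun j => by linear_combination H4 j + carletGray 2 (s.2.1 c₄).val j * two)
    exact ⟨x, fun j => by
      linear_combination H8 j - hx j + (carletGray 3 (s.2.2 c₈).val j - x) * two⟩

include F in
/-- A relation `h + p + q + r = κ (h + s + 1)` with `κ` in the kernel is trivial: either `κ` is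
constant or `h + s` lies in the kernel. -/
lemma trivial_of_relation {h p q r s κ : MixedSpace α₁ α₂ α₃} (hh : h ∈ G) (hp : p ∈ G)
    (hq : q ∈ G) (hr : r ∈ G) (hs : s ∈ G) (hκ : κ ∈ G) (hκ2 : 2 • κ = 0)
    (H : mixedGray h + mixedGray p + mixedGray q + mixedGray r =
      mixedGray κ * (mixedGray h + mixedGray s + 1)) :
    mixedGray κ = 0 ∨ mixedGray κ = 1 ∨ 2 • (h - s) = 0 := by
  have hquad : ∀ i, F.nu κ i = quad (zbit 2 (F.nu κ i)) := fun i => eq_quad_of_two_mul (by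
    simpa [nsmul_eq_mul, nu] using congrFun (congrArg (fun u => u.2.2) hκ2) (F.e₈ i))
  by_cases hall : ∀ i, zbit 2 (F.nu κ i) = κ.1 F.o
  · have h01 : ∀ x : ZMod 2, x = 0 ∨ x = 1 := by decide
    rcases h01 (κ.1 F.o) with h0 | h1
    · left
      have : κ = 0 := F.eq_zero κ hκ h0 fun i => by
        change F.nu κ i = 0
        rw [hquad, hall, h0]; decide
      rw [this]
      have := mixedGray_add (0 : MixedSpace α₁ α₂ α₃) 0 (by simp)
      simpa using this
    · right; left
      refine F.gray_ones κ hκ h1 fun i => ?_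
      change F.nu κ i = 4
      rw [hquad, hall, h1]; decide
  · right; right
    push Not at hall
    obtain ⟨i, hi⟩ := hall
    have key : ∀ {c₈ c₄}, _ := fun {c₈ c₄} =>
      F.zbit_eq_of_relation hh hp hq hr hs hκ hκ2 H (c₈ := c₈) (c₄ := c₄)
    have hsingle : ∀ j, zbit 2 (F.nu κ j) ≠ κ.1 F.o → zbit 0 (F.nu h j) = zbit 0 (F.nu s j) ∧
        zbit 1 (F.nu h j) = zbit 1 (F.nu s j) := fun j hj =>
      key (fun u hu => F.four_single u hu j) hj
    refine F.two_nsmul_eq_zero (G.sub_mem hh hs) fun j => ?_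
    suffices zbit 0 (F.nu h j) = zbit 0 (F.nu s j) ∧ zbit 1 (F.nu h j) = zbit 1 (F.nu s j) from
      two_mul_sub_eq_zero_of_zbit this.1 this.2
    by_cases hj : zbit 2 (F.nu κ j) = κ.1 F.o
    swap
    · exact hsingle j hj
    have hij : i ≠ j := by rintro rfl; exact hi hj
    have hi' := hsingle i hi
    have hs' := key (fun u hu => F.four_add u hu i j hij) (by
      rw [F.eight_add κ hκ i j hij]
      change zbit 2 (F.nu κ i + F.nu κ j + _) ≠ _
      rw [hquad i, hquad j]
      rw [← hj] at hi ⊢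
      clear hj
      generalize zbit 2 (F.nu κ i) = x at *
      generalize zbit 2 (F.nu κ j) = y at *
      revert x y; decide)
    rw [F.eight_add h hh i j hij, F.eight_add s hs i j hij] at hs'
    simp only [zbit_zero_add_quad, zbit_one_add_quad] at hs'
    simp only [zbit_zero_add, zbit_one_add] at hs'
    simp only [nu] at hi' ⊢
    rw [hi'.1, hi'.2] at hs'
    have e0 := add_left_cancel hs'.1
    refine ⟨e0, ?_⟩
    rw [e0] at hs'
    exact add_left_cancel (add_right_cancel hs'.2)

end Frame

/-- A subset of a level set of a surjective homomorphism `G → ℤ₂` that misses a point of the level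
set has fewer than half of the elements of `G`. -/
lemma two_mul_ncard_lt_card {E : Type} [AddCommGroup E] [Finite E] (G : AddSubgroup E)
    (χ : E → ZMod 2) (hχ : ∀ u v, χ (u + v) = χ u + χ v) {g : E} (hg : g ∈ G) (hg1 : χ g = 1)
    {Q : Set E} (hQ : Q ⊆ G) {c : ZMod 2} (hQc : ∀ q ∈ Q, χ q = c) {q₀ : E} (hq₀ : q₀ ∈ G)
    (hq₀c : χ q₀ = c) (hq₀Q : q₀ ∉ Q) : 2 * Q.ncard < Nat.card G := by
  have hS : (insert q₀ Q).ncard = Q.ncard + 1 := Set.ncard_insert_of_notMem hq₀Q (Set.toFinite _)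
  have hT : ((fun x => g + x) '' insert q₀ Q).ncard = Q.ncard + 1 := by
    rw [Set.ncard_image_of_injective _ (add_right_injective g), hS]
  have hc : ∀ x ∈ insert q₀ Q, χ x = c := by
    rintro x (rfl | hx)
    · exact hq₀c
    · exact hQc x hx
  have hd : Disjoint (insert q₀ Q) ((fun x => g + x) '' insert q₀ Q) := by
    rw [Set.disjoint_left]
    rintro _ hx ⟨y, hy, rfl⟩
    have h1 := hc _ hx
    rw [hχ, hg1, hc y hy] at h1
    revert h1
    clear * -
    revert c; decide
  have hsub : insert q₀ Q ∪ (fun x => g + x) '' insert q₀ Q ⊆ (G : Set E) := by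
    rintro x ((rfl | hx) | ⟨y, (rfl | hy), rfl⟩)
    · exact hq₀
    · exact hQ hx
    · exact G.add_mem hg hq₀
    · exact G.add_mem hg (hQ hy)
  have := Set.ncard_le_ncard hsub (Set.toFinite _)
  rw [Set.ncard_union_eq hd (Set.toFinite _) (Set.toFinite _), hS, hT] at this
  have e : (G : Set E).ncard = Nat.card G := rfl
  omega

namespace Frame

variable {α₁ α₂ α₃ m : ℕ} {G : AddSubgroup (MixedSpace α₁ α₂ α₃)} (F : Frame m G)

include F

/-- If `h + p` is not in the kernel, then fewer than half of the codewords `q` have the property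
that `h + p + q` is a codeword. -/
lemma two_mul_ncard_add_mem_lt (hm : 2 ≤ m) {h p : MixedSpace α₁ α₂ α₃} (hh : h ∈ G) (hp : p ∈ G)
    (hhp : 2 • (h - p) ≠ 0) :
    2 * {q | q ∈ G ∧ ∃ r ∈ G, mixedGray h + mixedGray p + mixedGray q + mixedGray r = 0}.ncard <
      Nat.card G := by
  have : Nontrivial (Fin m) := Fin.nontrivial_iff_two_le.2 hm
  have z0 : zbit 0 (0 : ZMod 8) = 0 := by decide
  have z1 : zbit 1 (0 : ZMod 8) = 0 := by decide
  have o0 : zbit 0 (1 : ZMod 8) = 1 := by decide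
  have t0 : zbit 0 (2 : ZMod 8) = 0 := by decide
  have t1 : zbit 1 (2 : ZMod 8) = 1 := by decide
  have hne : ∀ x y : ZMod 2, x ≠ y → x + y = 1 := by decide
  -- A word that differs from `h` by `2` in the single parameter `j`.
  have hshift : ∀ j, ∃ q ∈ G, (∀ k, zbit 0 (F.nu q k) = zbit 0 (F.nu h k)) ∧
      zbit 1 (F.nu h j) + zbit 1 (F.nu q j) = 1 ∧
      ∀ k, k ≠ j → zbit 1 (F.nu q k) = zbit 1 (F.nu h k) := by
    intro j
    obtain ⟨d, hd, -, hdν⟩ := F.exists_word 0 (Pi.single j 2)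
    have hj : F.nu d j = 2 := by rw [nu, hdν, Pi.single_eq_same]
    have hk : ∀ k, k ≠ j → F.nu d k = 0 := fun k hk => by
      rw [nu, hdν, Pi.single_eq_of_ne hk]
    refine ⟨h + d, G.add_mem hh hd, fun k => ?_, ?_, fun k hkj => ?_⟩
    · by_cases hkj : k = j
      · subst hkj; rw [nu_add, zbit_zero_add, hj, t0, add_zero]
      · rw [nu_add, hk k hkj, add_zero]
    · rw [nu_add, zbit_one_add, hj, t0, t1, mul_zero, add_zero, ← add_assoc,
        CharTwo.add_self_eq_zero, zero_add]
    · rw [nu_add, hk k hkj, add_zero]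
  by_cases hmod : ∀ i, zbit 0 (F.nu p i) = zbit 0 (F.nu h i)
  · -- The words `h` and `p` agree modulo `2` but not modulo `4`.
    obtain ⟨j, hj⟩ : ∃ j, zbit 1 (F.nu h j) ≠ zbit 1 (F.nu p j) := by
      by_contra! hcon
      exact hhp (F.two_nsmul_eq_zero (G.sub_mem hh hp) fun i =>
        two_mul_sub_eq_zero_of_zbit (hmod i).symm (hcon i))
    obtain ⟨i, hij⟩ := exists_ne j
    obtain ⟨q₀, hq₀, hq₀0, hq₀1, hq₀2⟩ := hshift i
    obtain ⟨g, hg, -, hgν⟩ := F.exists_word 0 (Pi.single i 1)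
    refine two_mul_ncard_lt_card G (fun u => zbit 0 (F.nu u i))
      (fun u v => by rw [nu_add, zbit_zero_add]) hg
      (by rw [nu, hgν, Pi.single_eq_same, o0]) (fun q hq => hq.1) (c := zbit 0 (F.nu h i))
      ?_ hq₀ (hq₀0 i) ?_
    · rintro q ⟨hq, r, hr, H⟩
      have h1 := F.sum_zbit_one_mul_zbit_zero hh hp hq hr H hij
      have h2 := (sum_zbit H (F.e₈ j)).2.1
      have h3 := (sum_zbit H (F.e₈ i)).1
      have h4 := hmod i
      simp only [nu] at *
      generalize zbit 0 (h.2.2 (F.e₈ i)) = a at *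
      rw [h4] at h1 h3
      clear * - h1 h2 h3 hj
      generalize zbit 0 (q.2.2 (F.e₈ i)) = a' at *
      generalize zbit 0 (r.2.2 (F.e₈ i)) = a'' at *
      generalize zbit 1 (h.2.2 (F.e₈ j)) = b at *
      generalize zbit 1 (p.2.2 (F.e₈ j)) = b' at *
      generalize zbit 1 (q.2.2 (F.e₈ j)) = c at *
      generalize zbit 1 (r.2.2 (F.e₈ j)) = c' at *
      revert a a' a'' b b' c c'; decide
    · rintro ⟨-, r, hr, H⟩
      have h1 := F.half_minor_eq_zero hh hp hq₀ hr H hij hmod hq₀0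
      rw [hq₀1, hq₀2 j hij.symm, CharTwo.add_self_eq_zero, mul_zero, zero_add, mul_one] at h1
      exact hj (CharTwo.add_eq_zero.1 h1)
  · -- The words `h` and `p` differ modulo `2`.
    push Not at hmod
    obtain ⟨i, hi⟩ := hmod
    obtain ⟨j, hij⟩ := exists_ne i
    obtain ⟨q₀, hq₀, hq₀0, hq₀1, -⟩ := hshift j
    obtain ⟨g, hg, -, hgν⟩ := F.exists_word 0 (Pi.single j 1)
    refine two_mul_ncard_lt_card G (fun u => zbit 0 (F.nu u j) +
        (zbit 0 (F.nu h j) + zbit 0 (F.nu p j)) * zbit 0 (F.nu u i))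
      (fun u v => by simp only [nu_add, zbit_zero_add]; ring) hg
      (by
        have hj1 : F.nu g j = 1 := by rw [nu, hgν, Pi.single_eq_same]
        have hi0 : F.nu g i = 0 := by rw [nu, hgν, Pi.single_eq_of_ne hij.symm]
        rw [hj1, hi0, o0, z0, mul_zero, add_zero])
      (fun q hq => hq.1) (c := zbit 0 (F.nu h j) +
        (zbit 0 (F.nu h j) + zbit 0 (F.nu p j)) * zbit 0 (F.nu h i))
      ?_ hq₀ (by rw [hq₀0, hq₀0]) ?_
    · rintro q ⟨hq, r, hr, H⟩
      have h1 := F.minor_eq_zero hh hp hq hr H hij.symm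
      rw [add_comm (zbit 0 (F.nu h i)), hne _ _ hi, one_mul] at h1
      have two : (2 : ZMod 2) = 0 := by decide
      linear_combination h1 - two * (zbit 0 (F.nu h j) +
        (zbit 0 (F.nu h j) + zbit 0 (F.nu p j)) * zbit 0 (F.nu h i))
    · rintro ⟨-, r, hr, H⟩
      have h1 := F.sum_zbit_one_mul_zbit_zero hh hp hq₀ hr H hij.symm
      have h2 := (sum_zbit H (F.e₈ j)).2.1
      have h3 := (sum_zbit H (F.e₈ i)).1
      have h4 := hq₀0 i
      simp only [nu] at *
      rw [h4] at h1 h3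
      clear * - h1 h2 h3 hi hq₀1
      generalize zbit 0 (h.2.2 (F.e₈ i)) = a at *
      generalize zbit 0 (p.2.2 (F.e₈ i)) = a' at *
      generalize zbit 0 (r.2.2 (F.e₈ i)) = a'' at *
      generalize zbit 1 (h.2.2 (F.e₈ j)) = b at *
      generalize zbit 1 (p.2.2 (F.e₈ j)) = b' at *
      generalize zbit 1 (q₀.2.2 (F.e₈ j)) = c at *
      generalize zbit 1 (r.2.2 (F.e₈ j)) = c' at *
      revert a a' a'' b b' c c'; decide

end Frame

/-! ### Equivalence of codes and kernels -/

/-- An equivalence onto a code that contains zero maps a translate of the first code, by one of its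
codewords, onto the second code by a permutation of the coordinates. -/
lemma CodeEquivalent.exists_perm {ι κ : Type} {C₁ : Set (ι → ZMod 2)} {C₂ : Set (κ → ZMod 2)}
    (h : CodeEquivalent C₁ C₂) (h0 : 0 ∈ C₂) :
    ∃ a ∈ C₁, ∃ π : ι ≃ κ, ∀ y, y ∈ C₂ ↔ a + y ∘ π ∈ C₁ := by
  obtain ⟨b, π, rfl⟩ := h
  obtain ⟨a, ha, hab⟩ := h0
  have hb : ∀ i, b (π i) = a i := by
    intro i
    have := congrFun hab (π i)
    simp only [Pi.add_apply, Function.comp_apply, Equiv.symm_apply_apply, Pi.zero_apply] at this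
    exact CharTwo.add_eq_zero.1 this
  refine ⟨a, ha, π, fun y => ⟨?_, fun hy => ⟨_, hy, ?_⟩⟩⟩
  · rintro ⟨c, hc, rfl⟩
    have : a + (b + c ∘ π.symm) ∘ π = c := by
      funext i
      simp only [Pi.add_apply, Function.comp_apply, Equiv.symm_apply_apply, hb]
      rw [← add_assoc, CharTwo.add_self_eq_zero, zero_add]
    simpa only [this] using hc
  · funext k
    obtain ⟨i, rfl⟩ := π.surjective k
    simp only [Pi.add_apply, Function.comp_apply, Equiv.symm_apply_apply, hb]
    rw [← add_assoc, CharTwo.add_self_eq_zero, zero_add]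

lemma CodeEquivalent.ncard_eq {ι κ : Type} {C₁ : Set (ι → ZMod 2)} {C₂ : Set (κ → ZMod 2)}
    (h : CodeEquivalent C₁ C₂) : C₂.ncard = C₁.ncard := by
  obtain ⟨b, π, rfl⟩ := h
  refine Set.ncard_image_of_injective _ fun x y hxy => ?_
  funext i
  simpa using congrFun hxy (π i)

section Kernel

variable {ι κ : Type} {C₁ : Set (ι → ZMod 2)} {C₂ : Set (κ → ZMod 2)} {a : ι → ZMod 2} {π : ι ≃ κ}
  (hmem : ∀ y, y ∈ C₂ ↔ a + y ∘ π ∈ C₁)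

include hmem

lemma mem_codeKernel_iff_comp (x : κ → ZMod 2) : x ∈ codeKernel C₂ ↔ x ∘ π ∈ codeKernel C₁ := by
  constructor
  · intro hx c hc
    have hy : a + ((a + c) ∘ π.symm) ∘ π = c := by
      funext i
      simp only [Pi.add_apply, Function.comp_apply, Equiv.symm_apply_apply]
      rw [← add_assoc, CharTwo.add_self_eq_zero, zero_add]
    have := (hmem _).1 (hx _ ((hmem ((a + c) ∘ π.symm)).2 (by rwa [hy])))
    convert this using 1
    calc x ∘ π + c = x ∘ π + (a + ((a + c) ∘ π.symm) ∘ π) := by rw [hy]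
      _ = a + (x + (a + c) ∘ π.symm) ∘ π := by
        funext i
        simp only [Pi.add_apply, Function.comp_apply]
        ring
  · intro hx c hc
    have := hx _ ((hmem c).1 hc)
    refine (hmem _).2 ?_
    convert this using 1
    funext i
    simp only [Pi.add_apply, Function.comp_apply]
    ring

lemma ncard_codeKernel_eq : (codeKernel C₂).ncard = (codeKernel C₁).ncard := by
  refine Set.ncard_congr (fun x _ => x ∘ π) (fun x hx => (mem_codeKernel_iff_comp hmem x).1 hx)
    (fun x y _ _ h => ?_) fun x hx => ⟨x ∘ π.symm, ?_, ?_⟩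
  · funext k
    simpa using congrFun h (π.symm k)
  · rw [mem_codeKernel_iff_comp hmem]
    convert hx
    funext i; simp
  · funext i; simp

end Kernel

/-! ### Two-torsion in finite abelian groups -/

section Torsion

variable {E : Type} [AddCommGroup E]

/-- The subgroup of the elements `u ∈ C` with `2 u = 0`. -/
def twoTorsion (C : AddSubgroup E) : AddSubgroup E := C ⊓ (nsmulAddMonoidHom 2 : E →+ E).ker

lemma mem_twoTorsion {C : AddSubgroup E} {u : E} : u ∈ twoTorsion C ↔ u ∈ C ∧ 2 • u = 0 := by
  simp [twoTorsion, AddMonoidHom.mem_ker]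

lemma card_eq_card_ker_mul_card_map {E' : Type} [AddCommGroup E'] (f : E →+ E')
    (C : AddSubgroup E) :
    Nat.card C = Nat.card ↥(C ⊓ f.ker) * Nat.card (C.map f) := by
  have h1 := AddSubgroup.card_mul_index (f.comp C.subtype).ker
  rw [AddSubgroup.index_ker] at h1
  rw [← h1]
  congr 1
  · refine Nat.card_congr ⟨fun x => ⟨x.1.1, x.1.2, x.2⟩, fun x => ⟨⟨x.1, x.2.1⟩, x.2.2⟩,
      fun _ => rfl, fun _ => rfl⟩
  · rw [AddMonoidHom.range_comp, AddSubgroup.range_subtype]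

lemma card_eq_card_twoTorsion_mul (C : AddSubgroup E) :
    Nat.card C = Nat.card (twoTorsion C) * Nat.card (C.map (nsmulAddMonoidHom 2 : E →+ E)) :=
  card_eq_card_ker_mul_card_map _ C

lemma card_le_card_twoTorsion_pow [Finite E] (k : ℕ) (C : AddSubgroup E)
    (hC : ∀ u ∈ C, 2 ^ k • u = 0) : Nat.card C ≤ Nat.card (twoTorsion C) ^ k := by
  induction k generalizing C with
  | zero =>
    have : C = ⊥ := (AddSubgroup.eq_bot_iff_forall C).2 fun u hu => by simpa using hC u hu
    simp [this]
  | succ k ih =>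
    rw [card_eq_card_twoTorsion_mul C, pow_succ, mul_comm]
    refine Nat.mul_le_mul_right _ ((ih _ ?_).trans (Nat.pow_le_pow_left ?_ _))
    · rintro _ ⟨u, hu, rfl⟩
      have := hC u hu
      rw [pow_succ, mul_smul] at this
      exact this
    · refine AddSubgroup.card_le_of_le fun u hu => ?_
      obtain ⟨⟨v, hv, rfl⟩, hu2⟩ := mem_twoTorsion.1 hu
      exact mem_twoTorsion.2 ⟨C.nsmul_mem hv 2, hu2⟩

lemma subset_codeKernel {κ : Type} {Φ : E → κ → ZMod 2}
    (hΦ : ∀ u v, 2 • u = 0 → Φ u + Φ v = Φ (u + v)) (C : AddSubgroup E) :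
    Φ '' (twoTorsion C : Set E) ⊆ codeKernel (Φ '' (C : Set E)) := by
  rintro _ ⟨u, hu, rfl⟩ _ ⟨v, hv, rfl⟩
  obtain ⟨hu, hu2⟩ := mem_twoTorsion.1 hu
  exact ⟨u + v, C.add_mem hu hv, (hΦ u v hu2).symm⟩

lemma gray_zero {κ : Type} {Φ : E → κ → ZMod 2}
    (hΦ : ∀ u v, 2 • u = 0 → Φ u + Φ v = Φ (u + v)) : Φ 0 = 0 := by
  have := hΦ 0 0 (smul_zero _)
  rwa [add_zero, add_eq_left] at this

end Torsion

namespace Frame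

variable {α₁ α₂ α₃ m : ℕ} {G : AddSubgroup (MixedSpace α₁ α₂ α₃)} (F : Frame m G)

include F

lemma card_eq : Nat.card G = 2 * 8 ^ m := by
  have e : Function.Bijective (fun u : G => (u.1.1 F.o, F.nu u.1)) := by
    constructor
    · rintro ⟨u, hu⟩ ⟨v, hv⟩ h
      rw [Prod.ext_iff] at h
      rw [Subtype.mk.injEq, ← sub_eq_zero]
      exact F.eq_zero _ (G.sub_mem hu hv) (sub_eq_zero.2 h.1)
        fun i => sub_eq_zero.2 (congrFun h.2 i)
    · rintro ⟨ε, ν⟩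
      obtain ⟨u, hu, h1, h2⟩ := F.exists_word ε ν
      exact ⟨⟨u, hu⟩, Prod.ext h1 (funext h2)⟩
  rw [Nat.card_congr (Equiv.ofBijective _ e)]
  simp

lemma card_twoTorsion_le : Nat.card (twoTorsion G) ≤ 2 ^ (m + 1) := by
  let f : twoTorsion G → ZMod 2 × (Fin m → ZMod 2) :=
    fun u => (u.1.1 F.o, fun i => zbit 2 (F.nu u.1 i))
  have hf : Function.Injective f := by
    rintro ⟨u, hu⟩ ⟨v, hv⟩ h
    obtain ⟨hu, hu2⟩ := mem_twoTorsion.1 hu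
    obtain ⟨hv, hv2⟩ := mem_twoTorsion.1 hv
    rw [Prod.ext_iff] at h
    rw [Subtype.mk.injEq, ← sub_eq_zero]
    refine F.eq_zero _ (G.sub_mem hu hv) (sub_eq_zero.2 h.1) fun i => sub_eq_zero.2 ?_
    have hq : ∀ {u : MixedSpace α₁ α₂ α₃}, 2 • u = 0 → F.nu u i = quad (zbit 2 (F.nu u i)) :=
      fun {u} hu => eq_quad_of_two_mul (by
        simpa [nsmul_eq_mul, nu] using congrFun (congrArg (fun u => u.2.2) hu) (F.e₈ i))
    have h1 : zbit 2 (F.nu u i) = zbit 2 (F.nu v i) := congrFun h.2 i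
    exact (hq hu2).trans ((congrArg quad h1).trans (hq hv2).symm)
  have := Nat.card_le_card_of_injective f hf
  simpa [pow_succ, mul_comm] using this

lemma codeKernel_eq (hm : 2 ≤ m) :
    codeKernel (mixedGray '' (G : Set (MixedSpace α₁ α₂ α₃))) =
      mixedGray '' (twoTorsion G : Set _) := by
  refine Set.Subset.antisymm (fun x hx => ?_) (subset_codeKernel mixedGray_add G)
  obtain ⟨u, hu, hu2, rfl⟩ := F.exists_of_mem_codeKernel hm hx
  exact ⟨u, mem_twoTorsion.2 ⟨hu, hu2⟩, rfl⟩

/-- A group code that is equivalent to the Gray image of `G` has as many words as `G`, and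
few of them have order two, because these give kernel elements. -/
lemma card_of_codeEquivalent (hm : 2 ≤ m) {E κ : Type} [AddCommGroup E] [Finite E] [Finite κ]
    {Φ : E → κ → ZMod 2} (hinj : Function.Injective Φ)
    (hΦ : ∀ u v, 2 • u = 0 → Φ u + Φ v = Φ (u + v)) (C : AddSubgroup E)
    (h : CodeEquivalent (mixedGray '' (G : Set (MixedSpace α₁ α₂ α₃))) (Φ '' (C : Set E))) :
    Nat.card C = 2 ^ (3 * m + 1) ∧ Nat.card (twoTorsion C) ≤ 2 ^ (m + 1) := by
  constructor
  · have := h.ncard_eq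
    rw [Set.ncard_image_of_injective _ hinj, Set.ncard_image_of_injective _ mixedGray_injective]
      at this
    change Nat.card C = Nat.card G at this
    rw [this, F.card_eq, pow_succ, pow_mul, mul_comm]
    norm_num
  · obtain ⟨a, -, π, hmem⟩ := h.exists_perm ⟨0, C.zero_mem, gray_zero hΦ⟩
    have h1 := Set.ncard_le_ncard (subset_codeKernel hΦ C) (Set.toFinite _)
    rw [ncard_codeKernel_eq hmem, F.codeKernel_eq hm, Set.ncard_image_of_injective _ hinj,
      Set.ncard_image_of_injective _ mixedGray_injective] at h1
    exact le_trans h1 F.card_twoTorsion_le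

/-- The Gray image of a group of exponent `4` has too large a kernel. -/
lemma not_codeEquivalent_of_four_nsmul (hm : 2 ≤ m) {E κ : Type} [AddCommGroup E] [Finite E]
    [Finite κ] {Φ : E → κ → ZMod 2} (hinj : Function.Injective Φ)
    (hΦ : ∀ u v, 2 • u = 0 → Φ u + Φ v = Φ (u + v)) (C : AddSubgroup E)
    (h4 : ∀ u ∈ C, 4 • u = 0) :
    ¬ CodeEquivalent (mixedGray '' (G : Set (MixedSpace α₁ α₂ α₃))) (Φ '' (C : Set E)) := by
  intro h
  obtain ⟨h1, h2⟩ := F.card_of_codeEquivalent hm hinj hΦ C h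
  have h3 := (card_le_card_twoTorsion_pow 2 C h4).trans (Nat.pow_le_pow_left h2 2)
  rw [h1, ← pow_mul, Nat.pow_le_pow_iff_right (by norm_num)] at h3
  omega

end Frame

/-! ### `ℤ₈`-linear codes -/

lemma sum_corr₈_eq_zero {n : ℕ} (D : AddSubgroup (Fin n → ZMod 8)) [Fintype D] {c : Fin n → ZMod 8}
    (hc : c ∈ D) {i : Fin n} (hci : c i ≠ 0) : ∑ d : D, corr₈ (d.1 i) = 0 := by
  have key : ∀ x : ZMod 8, x ≠ 0 → ∃ k : Fin 8, k.val • x = 4 := by decide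
  obtain ⟨k, hk⟩ := key _ hci
  have hneg : ∀ x : ZMod 8, corr₈ (x + 4) = - corr₈ x := by decide
  let d : D := ⟨k.val • c, D.nsmul_mem hc _⟩
  have h1 : ∑ x : D, corr₈ (x.1 i) = ∑ x : D, corr₈ ((x + d).1 i) :=
    (Equiv.sum_comp (Equiv.addRight d) fun x : D => corr₈ (x.1 i)).symm
  have h2 : ∀ x : D, corr₈ ((x + d).1 i) = - corr₈ (x.1 i) := by
    intro x
    rw [← hneg]
    exact congrArg (fun t => corr₈ (x.1 i + t)) hk
  simp only [h2, Finset.sum_neg_distrib] at h1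
  linarith

lemma sum_corr₈_nonneg {n : ℕ} (D : AddSubgroup (Fin n → ZMod 8)) [Fintype D] (i : Fin n) :
    0 ≤ ∑ d : D, corr₈ (d.1 i) := by
  by_cases h : ∀ c ∈ D, c i = 0
  · refine Finset.sum_nonneg fun d _ => ?_
    rw [h d.1 d.2]; decide
  · push Not at h
    obtain ⟨c, hc, hci⟩ := h
    rw [sum_corr₈_eq_zero D hc hci]

/-- If all correlations of the words of `C` vanish, except for the words `0` and `4`, and `C` is as
large as a Hadamard code, then `4` is a multiple of four in `C`. Indeed, summing the
correlations over a subgroup `D` that does not contain `4` gives `4 n`. For the kernel `D` of a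
coordinate this shows that no coordinate takes only even values; for `D = 4 C` it shows that
some coordinate vanishes on `4 C`, a contradiction unless `4 ∈ 4 C`. -/
lemma exists_four_nsmul_eq {n : ℕ} (hn : 0 < n) (C : AddSubgroup (Fin n → ZMod 8))
    (hcard : Nat.card C = 8 * n)
    (hcorr : ∀ c ∈ C, c ≠ 0 → c ≠ (fun _ => 4) → ∑ i, corr₈ (c i) = 0) :
    ∃ w ∈ C, 4 • w = fun _ => 4 := by
  classical
  have hsum : ∀ D : AddSubgroup (Fin n → ZMod 8), [Fintype D] → D ≤ C → (fun _ => 4) ∉ D →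
      ∑ i, ∑ d : D, corr₈ (d.1 i) = 4 * n := by
    intro D _ hDC h4
    rw [Finset.sum_comm, Finset.sum_eq_single (0 : D)]
    · have : corr₈ 0 = 4 := by decide
      simp [this, mul_comm]
    · intro d _ hd
      refine hcorr d.1 (hDC d.2) (fun h => hd (Subtype.ext h)) fun h => h4 ?_
      rw [← h]
      exact d.2
    · simp
  have hcoord : ∀ i, ∃ c ∈ C, 4 • c i ≠ 0 := by
    intro i
    by_contra! hcon
    let f : (Fin n → ZMod 8) →+ ZMod 8 := Pi.evalAddMonoidHom _ i
    let D := C ⊓ f.ker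
    have h4D : (fun _ => 4) ∉ D := by
      rintro ⟨-, h⟩
      have h' : (4 : ZMod 8) = 0 := h
      revert h'; decide
    have h1 := hsum D inf_le_left h4D
    have h2 : ∑ d : D, corr₈ (d.1 i) = 4 * Nat.card D := by
      have : ∀ d : D, corr₈ (d.1 i) = 4 := by
        intro d
        have h0 : d.1 i = 0 := d.2.2
        rw [h0]; decide
      simp [this, mul_comm]
    have h3 := Finset.single_le_sum (f := fun i => ∑ d : D, corr₈ (d.1 i))
      (fun i _ => sum_corr₈_nonneg D i) (Finset.mem_univ i)
    rw [h1] at h3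
    simp only [h2] at h3
    have h5 : Nat.card (C.map f) ≤ 4 := by
      have hsub : (C.map f : Set (ZMod 8)) ⊆ ({0, 2, 4, 6} : Finset (ZMod 8)) := by
        rintro _ ⟨c, hc, rfl⟩
        have key : ∀ x : ZMod 8, 4 • x = 0 → x ∈ ({0, 2, 4, 6} : Finset (ZMod 8)) := by decide
        exact key _ (hcon c hc)
      have := Set.ncard_le_ncard hsub (Set.toFinite _)
      rw [Set.ncard_coe_finset] at this
      exact this
    have h6 := card_eq_card_ker_mul_card_map f C
    rw [hcard] at h6
    have h7 : Nat.card D ≤ n := by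
      have : (4 : ℤ) * Nat.card D ≤ 4 * n := h3
      omega
    have h8 := Nat.mul_le_mul h7 h5
    change 8 * n = Nat.card D * _ at h6
    omega
  by_contra! hcon
  let D := C.map (nsmulAddMonoidHom 4 : (Fin n → ZMod 8) →+ _)
  have hDC : D ≤ C := by
    rintro _ ⟨c, hc, rfl⟩
    exact C.nsmul_mem hc 4
  have h4D : (fun _ => 4) ∉ D := by
    rintro ⟨w, hw, h⟩
    exact hcon w hw h
  have h1 := hsum D hDC h4D
  have h2 : ∑ i, ∑ d : D, corr₈ (d.1 i) = 0 := by
    refine Finset.sum_eq_zero fun i _ => ?_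
    obtain ⟨c, hc, hci⟩ := hcoord i
    exact sum_corr₈_eq_zero D (c := 4 • c) ⟨c, hc, rfl⟩ hci
  rw [h2] at h1
  omega

lemma hammingDist_add_comp {ι κ : Type} [Fintype ι] [Fintype κ] (x : ι → ZMod 2)
    (y : κ → ZMod 2) (π : ι ≃ κ) : hammingDist x (x + y ∘ π) = hammingDist y 0 := by
  unfold hammingDist
  refine Finset.card_equiv π fun i => ?_
  simp

lemma gray8_four {n : ℕ} : gray8 (fun _ : Fin n => 4) = 1 := by
  have key : ∀ j, carletGray 3 (4 : ZMod 8).val j = 1 := by decide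
  funext p
  exact key _

namespace Frame

variable {α₁ α₂ α₃ m : ℕ} {G : AddSubgroup (MixedSpace α₁ α₂ α₃)} (F : Frame m G)

include F

/-- The relations `y + (3 y + 2 w) + 2 w = 4 y · (2 y + 1)` between the Gray images of the words of
a `ℤ₈`-linear code cannot be satisfied by the Gray image of `G`. -/
lemma not_codeEquivalent_gray8 (hm : 2 ≤ m)
    (hN : Fintype.card (MixedCoord α₁ α₂ α₃) = 8 ^ m)
    (hdist : ∀ u ∈ G, ∀ v ∈ G, u ≠ v → mixedGray u + mixedGray v = 1 ∨
      2 * hammingDist (mixedGray u) (mixedGray v) = Fintype.card (MixedCoord α₁ α₂ α₃))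
    {n : ℕ} (C : AddSubgroup (Fin n → ZMod 8)) :
    ¬ CodeEquivalent (mixedGray '' (G : Set (MixedSpace α₁ α₂ α₃)))
      (gray8 '' (C : Set (Fin n → ZMod 8))) := by
  intro hequiv
  obtain ⟨hcard, htors⟩ := F.card_of_codeEquivalent hm gray8_injective gray8_add C hequiv
  have hz : gray8 (0 : Fin n → ZMod 8) = 0 := gray_zero gray8_add
  obtain ⟨_, ⟨h, hh, rfl⟩, π, hmem⟩ := hequiv.exists_perm ⟨0, C.zero_mem, hz⟩
  have hn : 4 * n = 8 ^ m := by
    rw [← hN, Fintype.card_congr π, Fintype.card_prod, Fintype.card_fin, Fintype.card_fin]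
    norm_num [mul_comm]
  have hn0 : 0 < n := by
    have : 0 < 8 ^ m := by positivity
    omega
  have hCn : Nat.card C = 8 * n := by
    have : (2 : ℕ) ^ (3 * m + 1) = 2 * 8 ^ m := by rw [pow_succ, pow_mul, mul_comm]; norm_num
    omega
  -- `V c` is the word of `G` that corresponds to `c`, up to the translation by `h`.
  have hV : ∀ c ∈ C, ∃ v ∈ G, mixedGray v = mixedGray h + gray8 c ∘ π :=
    fun c hc => (hmem _).1 ⟨c, hc, rfl⟩
  choose! V hVG hV using hV
  have four_ne : (fun _ : Fin n => (4 : ZMod 8)) ≠ 0 := by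
    intro h
    have := congrFun h ⟨0, hn0⟩
    revert this
    change (4 : ZMod 8) ≠ 0
    decide
  have hcorr : ∀ c ∈ C, c ≠ 0 → c ≠ (fun _ => 4) → ∑ i, corr₈ (c i) = 0 := by
    intro c hc hc0 hc4
    have hne : h ≠ V c := by
      intro heq
      have := hV c hc
      rw [← heq, left_eq_add] at this
      refine hc0 (gray8_injective ?_)
      rw [hz]
      funext p
      simpa using congrFun this (π.symm p)
    rcases hdist h hh (V c) (hVG c hc) hne with h1 | h1
    · refine absurd (gray8_injective ?_) hc4
      rw [gray8_four]
      rw [hV c hc, ← add_assoc, word_add_self, zero_add] at h1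
      funext p
      simpa using congrFun h1 (π.symm p)
    · rw [hV c hc, hammingDist_add_comp, hN, ← hn, ← hz] at h1
      have h2 := two_mul_hammingDist_gray8 c 0
      simp only [Pi.zero_apply, sub_zero] at h2
      omega
  obtain ⟨w, hwC, hw⟩ := exists_four_nsmul_eq hn0 C hCn hcorr
  have hw' : ∀ i, 4 * w i = 4 := fun i => by simpa [nsmul_eq_mul] using congrFun hw i
  -- By cardinality, the kernel elements are exactly the images of the words of order two.
  have hker : ∀ c ∈ C, gray8 c ∈ codeKernel (gray8 '' (C : Set (Fin n → ZMod 8))) → 2 • c = 0 := by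
    have hge : 2 ^ (m + 1) ≤ Nat.card (twoTorsion C) := by
      have h1 := card_le_card_twoTorsion_pow 3 C fun u _ => by
        funext i
        have key : ∀ x : ZMod 8, 2 ^ 3 • x = 0 := by decide
        exact key _
      have h2 : Nat.card (twoTorsion C) ∣ 2 ^ (3 * m + 1) := by
        rw [← hcard]
        exact AddSubgroup.card_dvd_of_le fun u hu => (mem_twoTorsion.1 hu).1
      obtain ⟨e, -, he⟩ := (Nat.dvd_prime_pow Nat.prime_two).1 h2
      rw [hcard, he, ← pow_mul, Nat.pow_le_pow_iff_right (by norm_num)] at h1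
      rw [he]
      exact Nat.pow_le_pow_right (by norm_num) (by omega)
    have heq := Set.eq_of_subset_of_ncard_le (subset_codeKernel gray8_add C) (by
      rw [ncard_codeKernel_eq hmem, F.codeKernel_eq hm,
        Set.ncard_image_of_injective _ mixedGray_injective,
        Set.ncard_image_of_injective _ gray8_injective]
      exact F.card_twoTorsion_le.trans hge) (Set.toFinite _)
    intro c _ hcK
    rw [← heq] at hcK
    obtain ⟨d, hd, hdc⟩ := hcK
    rw [← gray8_injective hdc]
    exact (mem_twoTorsion.1 hd).2
  have hkerV : ∀ c ∈ C, 2 • (h - V c) = 0 → 2 • c = 0 := by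
    intro c hc hc2
    refine hker c hc ((mem_codeKernel_iff_comp hmem _).2 ?_)
    have h1 : gray8 c ∘ π = mixedGray (h - V c) := by
      have h2 := mixedGray_add _ (V c) hc2
      rw [sub_add_cancel] at h2
      funext i
      have h5 := congrFun (hV c hc) i
      have h6 := congrFun h2 i
      simp only [Pi.add_apply] at h5 h6
      have two : (2 : ZMod 2) = 0 := by decide
      linear_combination h6 - h5 - mixedGray (h - V c) i * two
    rw [h1]
    exact subset_codeKernel mixedGray_add G
      ⟨_, mem_twoTorsion.2 ⟨G.sub_mem hh (hVG c hc), hc2⟩, rfl⟩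
  have hrel : ∀ y : Fin n → ZMod 8, gray8 y + gray8 (3 • y + 2 • w) + gray8 (2 • w) =
      gray8 (4 • y) * (gray8 (2 • y) + 1) := by
    intro y
    funext p
    have := carletGray_three_odd_relation (y p.1) (w p.1) (hw' p.1) p.2
    simp only [gray8, Pi.add_apply, Pi.mul_apply, nsmul_eq_mul, Pi.one_apply]
    exact_mod_cast this
  have h2w : 2 • w ∈ C := C.nsmul_mem hwC 2
  have hrelV : ∀ y ∈ C, mixedGray h + mixedGray (V (2 • w)) + mixedGray (V y) +
      mixedGray (V (3 • y + 2 • w)) =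
      (gray8 (4 • y) ∘ π) * (mixedGray h + mixedGray (V (2 • y)) + 1) := by
    intro y hy
    rw [hV _ h2w, hV _ hy, hV _ (C.add_mem (C.nsmul_mem hy 3) h2w), hV _ (C.nsmul_mem hy 2)]
    funext i
    have := congrFun (hrel y) (π i)
    simp only [Pi.add_apply, Pi.mul_apply, Function.comp_apply, Pi.one_apply] at this ⊢
    have two : (2 : ZMod 2) = 0 := by decide
    linear_combination this + (2 * mixedGray h i - gray8 (4 • y) (π i) * mixedGray h i) * two
  have hfour : ∀ y ∈ C, 4 • y = 0 ∨ 4 • y = fun _ => 4 := by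
    intro y hy
    have h4y : 4 • y ∈ twoTorsion C := by
      refine mem_twoTorsion.2 ⟨C.nsmul_mem hy 4, ?_⟩
      funext i
      have key : ∀ x : ZMod 8, 2 • (4 • x) = 0 := by decide
      exact key _
    have hk := (mem_codeKernel_iff_comp hmem _).1 (subset_codeKernel gray8_add C ⟨_, h4y, rfl⟩)
    obtain ⟨κ, hκ, hκ2, hκy⟩ := F.exists_of_mem_codeKernel hm hk
    have H := hrelV y hy
    rw [← hκy] at H
    rcases F.trivial_of_relation hh (hVG _ h2w) (hVG _ hy)
      (hVG _ (C.add_mem (C.nsmul_mem hy 3) h2w)) (hVG _ (C.nsmul_mem hy 2)) hκ hκ2 H with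
      h0 | h1 | h2
    · left
      refine gray8_injective ?_
      rw [hz]
      rw [hκy] at h0
      funext p
      simpa using congrFun h0 (π.symm p)
    · right
      refine gray8_injective ?_
      rw [gray8_four]
      rw [hκy] at h1
      funext p
      simpa using congrFun h1 (π.symm p)
    · left
      have := hkerV _ (C.nsmul_mem hy 2) h2
      rwa [smul_smul] at this
  -- Hence the elements `v` with `4 v = 0` make up half of `C`.
  let f : (Fin n → ZMod 8) →+ (Fin n → ZMod 8) := nsmulAddMonoidHom 4
  have hhalf : Nat.card C ≤ 2 * Nat.card ↥(C ⊓ f.ker) := by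
    rw [card_eq_card_ker_mul_card_map f C, mul_comm]
    refine Nat.mul_le_mul_right _ ?_
    have hsub : (C.map f : Set (Fin n → ZMod 8)) ⊆ {0, fun _ => 4} := by
      rintro _ ⟨y, hy, rfl⟩
      exact hfour y hy
    exact (Set.ncard_le_ncard hsub (Set.toFinite _)).trans
      ((Set.ncard_insert_le _ _).trans (by simp))
  have hnot : 2 • (h - V (2 • w)) ≠ 0 := by
    intro h0
    have := hkerV _ h2w h0
    rw [smul_smul] at this
    exact four_ne (hw.symm.trans this)
  have hlt := F.two_mul_ncard_add_mem_lt hm hh (hVG _ h2w) hnot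
  have hle : ((C ⊓ f.ker : AddSubgroup _) : Set (Fin n → ZMod 8)).ncard ≤
      {q | q ∈ G ∧ ∃ r ∈ G, mixedGray h + mixedGray (V (2 • w)) + mixedGray q +
        mixedGray r = 0}.ncard := by
    refine Set.ncard_le_ncard_of_injOn V ?_ ?_ (Set.toFinite _)
    · rintro v ⟨hv, hv4⟩
      refine ⟨hVG v hv, V (3 • v + 2 • w), hVG _ (C.add_mem (C.nsmul_mem hv 3) h2w), ?_⟩
      have h4 : 4 • v = 0 := hv4
      rw [hrelV v hv, h4, hz]
      funext i
      simp
    · rintro u ⟨hu, -⟩ v ⟨hv, -⟩ huv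
      have h1 := hV u hu
      rw [huv, hV v hv] at h1
      refine gray8_injective (funext fun p => ?_)
      simpa using (congrFun (add_left_cancel h1) (π.symm p)).symm
  have hG : Nat.card G = Nat.card C := by
    rw [F.card_eq, hCn]
    omega
  change Nat.card ↥(C ⊓ f.ker) ≤ _ at hle
  omega

end Frame

/-! ### Columns of the generator matrices -/

lemma mem_appendRow {r : ℕ} {R : Type} {x : R} {L : List (Fin r → R)} {c : Fin r → R}
    (hc : c ∈ L) : (Fin.snoc (α := fun _ => R) c x : Fin (r + 1) → R) ∈ appendRow x L :=
  List.mem_map.2 ⟨c, hc, rfl⟩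

lemma exists_of_mem_appendRow {r : ℕ} {R : Type} {x : R} {L : List (Fin r → R)}
    {c : Fin (r + 1) → R} (hc : c ∈ appendRow x L) :
    ∃ c' ∈ L, c = Fin.snoc (α := fun _ => R) c' x := by
  obtain ⟨c', h, rfl⟩ := List.mem_map.1 hc
  exact ⟨c', h, rfl⟩

lemma mem_newCols₄ {r : ℕ} {c : Fin r → ZMod 4} :
    c ∈ newCols₄ r ↔ ∀ i : Fin r, if i.val = 0 then c i = 2 else c i = 0 ∨ c i = 2 := by
  rw [newCols₄, Finset.mem_toList, Fintype.mem_piFinset]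
  refine forall_congr' fun i => ?_
  split_ifs <;> simp

lemma mem_newCols₈ {r : ℕ} {c : Fin r → ZMod 8} :
    c ∈ newCols₈ r ↔
      ∀ i : Fin r, if i.val = 0 then c i = 4 else c i = 0 ∨ c i = 2 ∨ c i = 4 ∨ c i = 6 := by
  rw [newCols₈, Finset.mem_toList, Fintype.mem_piFinset]
  refine forall_congr' fun i => ?_
  split_ifs <;> simp

/-- A column of the binary part of `A^{a+1,0,1}`: the top entry is `1`, the others are arbitrary. -/
lemma mem_cols₁ (a : ℕ) (c : Fin (a + 2) → ZMod 2) (h0 : c 0 = 1) :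
    c ∈ (genMatrix₈ a).cols₁ := by
  induction a with
  | zero =>
    have key : ∀ x : ZMod 2, x = 0 ∨ x = 1 := by decide
    have hc : c = ![1, c 1] := by
      funext i
      fin_cases i
      · exact h0
      · rfl
    rw [hc]
    rcases key (c 1) with h | h <;> rw [h] <;> simp [genMatrix₈, baseMatrix]
  | succ a ih =>
    have key : ∀ x : ZMod 2, x = 0 ∨ x = 1 := by decide
    have h1 := ih (Fin.init c) h0
    rw [← Fin.snoc_init_self c, genMatrix₈, addRow₈, List.mem_append]
    rcases key (c (Fin.last _)) with h | h <;> rw [h]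
    · exact Or.inl (mem_appendRow h1)
    · exact Or.inr (mem_appendRow h1)

/-- A column of the quaternary part of `A^{a+1,0,1}`: below the top entry `2`, the first odd
entry is `1`. -/
lemma mem_cols₂ (a : ℕ) (c : Fin (a + 2) → ZMod 4) (h0 : c 0 = 2) (f : Fin (a + 2))
    (hf : f ≠ 0) (hcf : c f = 1) (hlt : ∀ j, j ≠ 0 → j < f → c j = 0 ∨ c j = 2) :
    c ∈ (genMatrix₈ a).cols₂ := by
  induction a with
  | zero =>
    have hf1 : ∀ f : Fin 2, f ≠ 0 → f = 1 := by decide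
    obtain rfl := hf1 f hf
    have hc : c = ![2, 1] := by
      funext i
      fin_cases i
      · exact h0
      · exact hcf
    rw [hc]
    simp [genMatrix₈, baseMatrix]
  | succ a ih =>
    rw [← Fin.snoc_init_self c, genMatrix₈, addRow₈, List.mem_append]
    induction f using Fin.lastCases with
    | last =>
      left
      rw [hcf]
      refine mem_appendRow (mem_newCols₄.2 fun i => ?_)
      split_ifs with hi
      · rw [show i = 0 from Fin.ext hi]; exact h0
      · exact hlt i.castSucc (fun h => hi (congrArg Fin.val h)) (Fin.castSucc_lt_last i)
    | cast f =>
      right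
      have key : ∀ x : ZMod 4, x ∈ [0, 1, 2, 3] := by decide
      refine List.mem_flatMap.2 ⟨_, key _, mem_appendRow (ih (Fin.init c) h0 f ?_ hcf ?_)⟩
      · rintro rfl; exact hf rfl
      · intro j hj hjf
        exact hlt j.castSucc (Fin.castSucc_ne_zero_iff.2 hj) hjf

/-- A column of the octal part of `A^{a+1,0,1}`: below the top entry `4`, the first odd entry
is `1`. -/
lemma mem_cols₃ (a : ℕ) (c : Fin (a + 2) → ZMod 8) (h0 : c 0 = 4) (f : Fin (a + 2))
    (hf : f ≠ 0) (hcf : c f = 1)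
    (hlt : ∀ j, j ≠ 0 → j < f → c j = 0 ∨ c j = 2 ∨ c j = 4 ∨ c j = 6) :
    c ∈ (genMatrix₈ a).cols₃ := by
  induction a with
  | zero =>
    have hf1 : ∀ f : Fin 2, f ≠ 0 → f = 1 := by decide
    obtain rfl := hf1 f hf
    have hc : c = ![4, 1] := by
      funext i
      fin_cases i
      · exact h0
      · exact hcf
    rw [hc]
    simp [genMatrix₈, baseMatrix]
  | succ a ih =>
    rw [← Fin.snoc_init_self c, genMatrix₈, addRow₈, List.mem_append]
    induction f using Fin.lastCases with
    | last =>
      left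
      rw [hcf]
      refine mem_appendRow (mem_newCols₈.2 fun i => ?_)
      split_ifs with hi
      · rw [show i = 0 from Fin.ext hi]; exact h0
      · exact hlt i.castSucc (fun h => hi (congrArg Fin.val h)) (Fin.castSucc_lt_last i)
    | cast f =>
      right
      have key : ∀ x : ZMod 8, x ∈ [0, 1, 2, 3, 4, 5, 6, 7] := by decide
      refine List.mem_flatMap.2 ⟨_, key _, mem_appendRow (ih (Fin.init c) h0 f ?_ hcf ?_)⟩
      · rintro rfl; exact hf rfl
      · intro j hj hjf
        exact hlt j.castSucc (Fin.castSucc_ne_zero_iff.2 hj) hjf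

/-- The first row of `A^{a+1,0,1}` is `(1, …, 1 | 2, …, 2 | 4, …, 4)`. -/
lemma genMatrix₈_top (a : ℕ) : (∀ c ∈ (genMatrix₈ a).cols₁, c 0 = 1) ∧
    (∀ c ∈ (genMatrix₈ a).cols₂, c 0 = 2) ∧ ∀ c ∈ (genMatrix₈ a).cols₃, c 0 = 4 := by
  induction a with
  | zero => simp [genMatrix₈, baseMatrix]
  | succ a ih =>
    obtain ⟨h1, h2, h3⟩ := ih
    refine ⟨fun c hc => ?_, fun c hc => ?_, fun c hc => ?_⟩
    · rcases List.mem_append.1 hc with hc | hc <;>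
      · obtain ⟨c', hc', rfl⟩ := exists_of_mem_appendRow hc
        exact h1 c' hc'
    · rcases List.mem_append.1 hc with hc | hc
      · obtain ⟨c', hc', rfl⟩ := exists_of_mem_appendRow hc
        exact mem_newCols₄.1 hc' 0
      · obtain ⟨x, -, hc⟩ := List.mem_flatMap.1 hc
        obtain ⟨c', hc', rfl⟩ := exists_of_mem_appendRow hc
        exact h2 c' hc'
    · rcases List.mem_append.1 hc with hc | hc
      · obtain ⟨c', hc', rfl⟩ := exists_of_mem_appendRow hc
        exact mem_newCols₈.1 hc' 0
      · obtain ⟨x, -, hc⟩ := List.mem_flatMap.1 hc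
        obtain ⟨c', hc', rfl⟩ := exists_of_mem_appendRow hc
        exact h3 c' hc'

lemma length_newCols₄ (r : ℕ) : (newCols₄ (r + 1)).length = 2 ^ r := by
  rw [newCols₄, Finset.length_toList, Fintype.card_piFinset, Fin.prod_univ_succ]
  simp [Finset.card_pair (show (0 : ZMod 4) ≠ 2 by decide)]

lemma length_newCols₈ (r : ℕ) : (newCols₈ (r + 1)).length = 4 ^ r := by
  have : ({0, 2, 4, 6} : Finset (ZMod 8)).card = 4 := by decide
  rw [newCols₈, Finset.length_toList, Fintype.card_piFinset, Fin.prod_univ_succ]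
  simp [this]

lemma length_appendRow {r : ℕ} {R : Type} (x : R) (L : List (Fin r → R)) :
    (appendRow x L).length = L.length := List.length_map _

lemma length_genMatrix₈ (a : ℕ) : (genMatrix₈ a).cols₁.length = 2 ^ (a + 1) ∧
    (genMatrix₈ a).cols₁.length + 2 * (genMatrix₈ a).cols₂.length = 4 ^ (a + 1) ∧
    (genMatrix₈ a).cols₁.length + 2 * (genMatrix₈ a).cols₂.length +
      4 * (genMatrix₈ a).cols₃.length = 8 ^ (a + 1) := by
  induction a with
  | zero => simp [genMatrix₈, baseMatrix]
  | succ a ih =>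
    simp only [genMatrix₈, addRow₈, List.length_append, length_appendRow, length_newCols₄,
      length_newCols₈, List.flatMap_cons, List.flatMap_nil, List.length_nil]
    rw [pow_succ 2 (a + 1), pow_succ 4 (a + 1), pow_succ 8 (a + 1)]
    omega

lemma length_genMatrix₄ (a b : ℕ) : (genMatrix₄ a b).cols₁.length = 2 ^ (a + 1 + b) ∧
    (genMatrix₄ a b).cols₁.length + 2 * (genMatrix₄ a b).cols₂.length = 4 ^ (a + 1 + b) ∧
    (genMatrix₄ a b).cols₁.length + 2 * (genMatrix₄ a b).cols₂.length +
      4 * (genMatrix₄ a b).cols₃.length = 8 ^ (a + 1) * 4 ^ b := by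
  induction b with
  | zero => simpa [genMatrix₄] using length_genMatrix₈ a
  | succ b ih =>
    have e : (newCols₄ ((a + 2).add b)).length = 2 ^ (a + 1 + b) := by
      rw [show (a + 2).add b = (a + 1 + b) + 1 from add_right_comm (a + 1) 1 b, length_newCols₄]
    simp only [genMatrix₄, addRow₄, List.length_append, length_appendRow,
      List.flatMap_cons, List.flatMap_nil, List.length_nil]
    rw [e, ← add_assoc (a + 1) b 1, pow_succ 2 (a + 1 + b), pow_succ 4 (a + 1 + b), pow_succ 4 b,
      ← mul_assoc]
    omega

lemma length_genMatrix₂ (a b c : ℕ) : (genMatrix₂ a b c).cols₁.length +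
    2 * (genMatrix₂ a b c).cols₂.length + 4 * (genMatrix₂ a b c).cols₃.length =
      8 ^ (a + 1) * 4 ^ b * 2 ^ c := by
  induction c with
  | zero => simpa [genMatrix₂] using (length_genMatrix₄ a b).2.2
  | succ c ih =>
    simp only [genMatrix₂, addRow₂, List.length_append, length_appendRow]
    rw [pow_succ 2 c, ← mul_assoc]
    omega

/-! ### Orders of the rows -/

/-- The numbers `n i` are positive and even, and `n i` annihilates the `i`-th row of `A`. -/
structure MixedMatrix.Annihilates {r : ℕ} (A : MixedMatrix r) (n : Fin r → ℕ) : Prop where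
  even : ∀ i, 0 < n i / 2 ∧ n i = 2 * (n i / 2)
  cols₂ : ∀ c ∈ A.cols₂, ∀ i, (n i : ZMod 4) * c i = 0
  cols₃ : ∀ c ∈ A.cols₃, ∀ i, (n i : ZMod 8) * c i = 0

lemma snoc_mul_eq_zero {r : ℕ} {R : Type} [CommRing R] {n : Fin r → ℕ} {k : ℕ} {c : Fin r → R}
    {x : R} (hc : ∀ i, (n i : R) * c i = 0) (hx : (k : R) * x = 0) (i : Fin (r + 1)) :
    ((Fin.snoc (α := fun _ => ℕ) n k i : ℕ) : R) * Fin.snoc (α := fun _ => R) c x i = 0 := by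
  induction i using Fin.lastCases with
  | last => simpa using hx
  | cast i => simpa using hc i

lemma snoc_even {r : ℕ} {n : Fin r → ℕ} {k : ℕ} (hn : ∀ i, 0 < n i / 2 ∧ n i = 2 * (n i / 2))
    (hk : 0 < k / 2 ∧ k = 2 * (k / 2)) (i : Fin (r + 1)) :
    0 < Fin.snoc (α := fun _ => ℕ) n k i / 2 ∧
      Fin.snoc (α := fun _ => ℕ) n k i = 2 * (Fin.snoc (α := fun _ => ℕ) n k i / 2) := by
  induction i using Fin.lastCases with
  | last => simpa using hk
  | cast i => simpa using hn i

lemma prod_snoc_div_two {r : ℕ} (n : Fin r → ℕ) (k : ℕ) :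
    ∏ i, Fin.snoc (α := fun _ => ℕ) n k i / 2 = (∏ i, n i / 2) * (k / 2) := by
  rw [Fin.prod_univ_castSucc]
  simp

lemma newCols₄_mul_eq_zero {r : ℕ} {n : Fin r → ℕ} (hn : ∀ i, 0 < n i / 2 ∧ n i = 2 * (n i / 2))
    {c : Fin r → ZMod 4} (hc : c ∈ newCols₄ r) (i : Fin r) : (n i : ZMod 4) * c i = 0 := by
  have h := mem_newCols₄.1 hc i
  have h2 : c i = 0 ∨ c i = 2 := by
    split_ifs at h
    · exact Or.inr h
    · exact h
  have key : ∀ x : ZMod 4, 2 * x * 2 = 0 := by decide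
  rw [(hn i).2]
  push_cast
  rcases h2 with h2 | h2 <;> rw [h2]
  · rw [mul_zero]
  · exact key _

lemma annihilates_genMatrix₈ (a : ℕ) :
    (genMatrix₈ a).Annihilates (Fin.cons (α := fun _ => ℕ) 2 fun _ => 8) := by
  have h8 : ∀ x : ZMod 8, 8 * x = 0 := by decide
  have h8' : ∀ x : ZMod 4, 8 * x = 0 := by decide
  refine ⟨fun i => ?_, fun c hc i => ?_, fun c hc i => ?_⟩ <;>
    induction i using Fin.cases with
    | zero => ?_
    | succ i => ?_
  · simp
  · simp
  · rw [(genMatrix₈_top a).2.1 c hc, Fin.cons_zero]; decide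
  · rw [Fin.cons_succ]; exact_mod_cast h8' _
  · rw [(genMatrix₈_top a).2.2 c hc, Fin.cons_zero]; decide
  · rw [Fin.cons_succ]; exact_mod_cast h8 _

lemma exists_annihilates_genMatrix₄ (a b : ℕ) : ∃ n, (genMatrix₄ a b).Annihilates n ∧
    ∏ i, n i / 2 = 4 ^ (a + 1) * 2 ^ b := by
  induction b with
  | zero =>
    refine ⟨_, annihilates_genMatrix₈ a, ?_⟩
    change ∏ i : Fin (a + 1 + 1), _ = _
    rw [Fin.prod_univ_succ]
    simp
  | succ b ih =>
    obtain ⟨n, hn, hprod⟩ := ih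
    refine ⟨Fin.snoc (α := fun _ => ℕ) n 4, ⟨snoc_even hn.even (by norm_num), ?_, ?_⟩, ?_⟩
    · intro c hc
      have h4 : ∀ x : ZMod 4, ((4 : ℕ) : ZMod 4) * x = 0 := by decide
      rcases List.mem_append.1 hc with hc | hc
      · obtain ⟨c', hc', rfl⟩ := exists_of_mem_appendRow hc
        exact snoc_mul_eq_zero (newCols₄_mul_eq_zero hn.even hc') (h4 _)
      · obtain ⟨x, -, hc⟩ := List.mem_flatMap.1 hc
        obtain ⟨c', hc', rfl⟩ := exists_of_mem_appendRow hc
        exact snoc_mul_eq_zero (hn.cols₂ c' hc') (h4 _)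
    · intro c hc
      have h4 : ∀ x ∈ ([0, 2, 4, 6] : List (ZMod 8)), ((4 : ℕ) : ZMod 8) * x = 0 := by decide
      obtain ⟨x, hx, hc⟩ := List.mem_flatMap.1 hc
      obtain ⟨c', hc', rfl⟩ := exists_of_mem_appendRow hc
      exact snoc_mul_eq_zero (hn.cols₃ c' hc') (h4 x hx)
    · refine (prod_snoc_div_two n 4).trans ?_
      rw [hprod, pow_succ]
      ring

lemma exists_annihilates_genMatrix₂ (a b c : ℕ) : ∃ n, (genMatrix₂ a b c).Annihilates n ∧
    ∏ i, n i / 2 = 4 ^ (a + 1) * 2 ^ b := by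
  induction c with
  | zero => exact exists_annihilates_genMatrix₄ a b
  | succ c ih =>
    obtain ⟨n, hn, hprod⟩ := ih
    refine ⟨Fin.snoc (α := fun _ => ℕ) n 2, ⟨snoc_even hn.even (by norm_num), ?_, ?_⟩, ?_⟩
    · intro d hd
      rcases List.mem_append.1 hd with hd | hd <;>
      · obtain ⟨d', hd', rfl⟩ := exists_of_mem_appendRow hd
        exact snoc_mul_eq_zero (hn.cols₂ d' hd') (by decide)
    · intro d hd
      rcases List.mem_append.1 hd with hd | hd <;>
      · obtain ⟨d', hd', rfl⟩ := exists_of_mem_appendRow hd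
        exact snoc_mul_eq_zero (hn.cols₃ d' hd') (by decide)
    · refine (prod_snoc_div_two n 2).trans ?_
      rw [hprod]
      norm_num

lemma MixedMatrix.Annihilates.nsmul_row {r : ℕ} {A : MixedMatrix r} {n : Fin r → ℕ}
    (h : A.Annihilates n) (i : Fin r) : n i • A.row i = 0 := by
  refine Prod.ext (funext fun j => ?_) (Prod.ext (funext fun j => ?_) (funext fun j => ?_))
  · have key : ∀ x : ZMod 2, 2 * x = 0 := by decide
    change n i • A.cols₁.get j i = 0
    rw [nsmul_eq_mul, (h.even i).2]
    push_cast
    rw [mul_assoc]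
    exact key _
  · change n i • A.cols₂.get j i = 0
    rw [nsmul_eq_mul]
    exact h.cols₂ _ (List.get_mem _ _) i
  · change n i • A.cols₃.get j i = 0
    rw [nsmul_eq_mul]
    exact h.cols₃ _ (List.get_mem _ _) i

/-- The doubled words number at most `∏ i, n i / 2`, since the coefficient of the `i`-th
generator only matters modulo `n i / 2`. -/
lemma card_map_two_nsmul_closure_le {E : Type} [AddCommGroup E] {r : ℕ} (v : Fin r → E)
    (n : Fin r → ℕ) (hn : ∀ i, 0 < n i / 2 ∧ n i = 2 * (n i / 2)) (hv : ∀ i, n i • v i = 0) :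
    Nat.card ((AddSubgroup.closure (Set.range v)).map (nsmulAddMonoidHom 2 : E →+ E)) ≤
      ∏ i, n i / 2 := by
  let f : (∀ i, Fin (n i / 2)) → E := fun k => ∑ i, (k i).val • (2 • v i)
  have hsub : ((AddSubgroup.closure (Set.range v)).map (nsmulAddMonoidHom 2 : E →+ E) : Set E) ⊆
      Set.range f := by
    rintro _ ⟨u, hu, rfl⟩
    obtain ⟨k, rfl⟩ := AddSubgroup.exists_of_mem_closure_range v u hu
    have hpos : ∀ i, (0 : ℤ) < (n i / 2 : ℕ) := fun i => by exact_mod_cast (hn i).1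
    refine ⟨fun i => ⟨(k i % (n i / 2 : ℕ)).toNat, ?_⟩, ?_⟩
    · have h1 := Int.emod_nonneg (k i) (hpos i).ne'
      have h2 := Int.emod_lt_of_pos (k i) (hpos i)
      omega
    · change ∑ i, _ = 2 • ∑ i, k i • v i
      rw [Finset.smul_sum]
      refine Finset.sum_congr rfl fun i _ => ?_
      have h1 := Int.toNat_of_nonneg (Int.emod_nonneg (k i) (hpos i).ne')
      change (k i % (n i / 2 : ℕ)).toNat • 2 • v i = _
      rw [← natCast_zsmul, h1]
      conv_rhs => rw [smul_comm, ← Int.emod_add_mul_ediv (k i) (n i / 2 : ℕ), add_smul]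
      have h2 : (((n i / 2 : ℕ) : ℤ) * (k i / (n i / 2 : ℕ))) • (2 • v i) = 0 := by
        rw [mul_comm, mul_smul, natCast_zsmul, smul_smul, mul_comm, ← (hn i).2, hv, smul_zero]
      rw [h2, add_zero]
  have h1 := Set.ncard_le_ncard hsub (Set.finite_range f)
  have h2 : (Set.range f).ncard ≤ Nat.card (∀ i, Fin (n i / 2)) := by
    rw [← Set.image_univ, ← Set.ncard_univ]
    exact Set.ncard_image_le (Set.toFinite _)
  refine h1.trans (h2.trans ?_)
  rw [Nat.card_pi]
  simp

lemma card_le_card_twoTorsion_mul (a b c : ℕ) :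
    Nat.card (genMatrix₂ a b c).additiveCode ≤
      Nat.card (twoTorsion (genMatrix₂ a b c).additiveCode) * (4 ^ (a + 1) * 2 ^ b) := by
  obtain ⟨n, hn, hprod⟩ := exists_annihilates_genMatrix₂ a b c
  rw [card_eq_card_twoTorsion_mul, ← hprod]
  exact Nat.mul_le_mul_left _ (card_map_two_nsmul_closure_le _ n hn.even hn.nsmul_row)

/-! ### The code `H^{m,0,1}` has a frame -/

namespace MixedMatrix

variable {r : ℕ} (A : MixedMatrix r)

/-- The combination of the rows of `A` with coefficients `k`. -/
def comb (k : Fin r → ℤ) : A.Space := ∑ i, k i • A.row i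

lemma comb_mem (k : Fin r → ℤ) : A.comb k ∈ A.additiveCode :=
  A.additiveCode.sum_mem fun i _ =>
    A.additiveCode.zsmul_mem (AddSubgroup.subset_closure ⟨i, rfl⟩) _

lemma exists_comb {u : A.Space} (hu : u ∈ A.additiveCode) : ∃ k, u = A.comb k :=
  AddSubgroup.exists_of_mem_closure_range _ _ hu

lemma comb_fst (k : Fin r → ℤ) (j : Fin A.cols₁.length) :
    (A.comb k).1 j = ∑ i, (k i : ZMod 2) * A.cols₁.get j i := by
  rw [comb, Prod.fst_sum, Finset.sum_apply]
  simp [row]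

lemma comb_snd_fst (k : Fin r → ℤ) (j : Fin A.cols₂.length) :
    (A.comb k).2.1 j = ∑ i, (k i : ZMod 4) * A.cols₂.get j i := by
  rw [comb, Prod.snd_sum, Prod.fst_sum, Finset.sum_apply]
  simp [row]

lemma comb_snd_snd (k : Fin r → ℤ) (j : Fin A.cols₃.length) :
    (A.comb k).2.2 j = ∑ i, (k i : ZMod 8) * A.cols₃.get j i := by
  rw [comb, Prod.snd_sum, Prod.snd_sum, Finset.sum_apply]
  simp [row]

end MixedMatrix

lemma sum_mul_cons {n : ℕ} {R : Type} [CommRing R] (k : Fin (n + 1) → R) (x : R) (v : Fin n → R) :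
    ∑ i, k i * (Fin.cons x v : Fin (n + 1) → R) i = k 0 * x + ∑ i : Fin n, k i.succ * v i := by
  rw [Fin.sum_univ_succ]
  simp

lemma exists_get_cols₃ (a : ℕ) (v : Fin (a + 1) → ZMod 8) (f : Fin (a + 1)) (hf : v f = 1)
    (hlt : ∀ j, j < f → v j = 0 ∨ v j = 2) :
    ∃ c, (genMatrix₈ a).cols₃.get c = (Fin.cons (α := fun _ => ZMod 8) 4 v) := by
  refine List.mem_iff_get.1 (mem_cols₃ a _ rfl f.succ (Fin.succ_ne_zero f) (by simpa using hf) ?_)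
  intro j hj hjf
  obtain ⟨j, rfl⟩ := Fin.exists_succ_eq.2 hj
  rw [Fin.cons_succ]
  rcases hlt j (Fin.succ_lt_succ_iff.1 hjf) with h | h <;> simp [h]

lemma exists_get_cols₂ (a : ℕ) (v : Fin (a + 1) → ZMod 4) (f : Fin (a + 1)) (hf : v f = 1)
    (hlt : ∀ j, j < f → v j = 0 ∨ v j = 2) :
    ∃ c, (genMatrix₈ a).cols₂.get c = (Fin.cons (α := fun _ => ZMod 4) 2 v) := by
  refine List.mem_iff_get.1 (mem_cols₂ a _ rfl f.succ (Fin.succ_ne_zero f) (by simpa using hf) ?_)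
  intro j hj hjf
  obtain ⟨j, rfl⟩ := Fin.exists_succ_eq.2 hj
  rw [Fin.cons_succ]
  exact hlt j (Fin.succ_lt_succ_iff.1 hjf)

/-- In a sum of two distinct unit vectors, the first nonzero entry is `1`. -/
lemma exists_first_single_add {n : ℕ} {R : Type} [CommRing R] {i j : Fin n} (hij : i ≠ j) :
    ∃ f, (Pi.single i 1 + Pi.single j 1 : Fin n → R) f = 1 ∧
      ∀ k, k < f → (Pi.single i 1 + Pi.single j 1 : Fin n → R) k = 0 := by
  refine ⟨min i j, ?_, fun k hk => ?_⟩
  · rcases lt_or_gt_of_ne hij with h | h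
    · rw [min_eq_left h.le, Pi.add_apply, Pi.single_eq_same, Pi.single_eq_of_ne hij, add_zero]
    · rw [min_eq_right h.le, Pi.add_apply, Pi.single_eq_same, Pi.single_eq_of_ne hij.symm,
        zero_add]
  · obtain ⟨h1, h2⟩ := lt_min_iff.1 hk
    rw [Pi.add_apply, Pi.single_eq_of_ne h1.ne, Pi.single_eq_of_ne h2.ne, add_zero]

/-- Reduction of an octal entry `4 x + y` modulo `4`, compared with the quaternary entry
`2 x + y`. -/
lemma zbit_reduction (x y : ℤ) :
    zbit 0 ((x : ZMod 4) * 2 + (y : ZMod 4)) = zbit 0 ((x : ZMod 8) * 4 + (y : ZMod 8)) ∧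
      zbit 1 ((x : ZMod 4) * 2 + (y : ZMod 4)) =
        zbit 1 ((x : ZMod 8) * 4 + (y : ZMod 8)) + (x : ZMod 2) := by
  have key : ∀ x y : ZMod 8,
      zbit 0 ((x.cast : ZMod 4) * 2 + y.cast) = zbit 0 (x * 4 + y) ∧
        zbit 1 ((x.cast : ZMod 4) * 2 + y.cast) = zbit 1 (x * 4 + y) + (x.cast : ZMod 2) := by
    decide
  have := key x y
  rwa [ZMod.cast_intCast (by norm_num), ZMod.cast_intCast (by norm_num),
    ZMod.cast_intCast (by norm_num)] at this

lemma quad_intCast (x : ℤ) : quad (x : ZMod 2) = (x : ZMod 8) * 4 := by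
  have key : ∀ x : ZMod 8, quad (x.cast : ZMod 2) = x * 4 := by decide
  have := key x
  rwa [ZMod.cast_intCast (by norm_num)] at this

lemma quad_add_self (e : ZMod 2) : quad e + quad e = 0 := by revert e; decide

/-- The first row of `A^{a+1,0,1}` has the all-one word as Gray image. -/
lemma mixedGray_row_zero (a : ℕ) : mixedGray ((genMatrix₈ a).row 0) = 1 := by
  obtain ⟨h1, h2, h3⟩ := genMatrix₈_top a
  have k2 : ∀ j, carletGray 2 (2 : ZMod 4).val j = 1 := by decide
  have k3 : ∀ j, carletGray 3 (4 : ZMod 8).val j = 1 := by decide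
  funext p
  rcases p with i | ⟨i, j⟩ | ⟨i, j⟩
  · exact h1 _ (List.get_mem _ i)
  · change carletGray 2 ((genMatrix₈ a).cols₂.get i 0).val j = 1
    rw [h2 _ (List.get_mem _ i), k2]
  · change carletGray 3 ((genMatrix₈ a).cols₃.get i 0).val j = 1
    rw [h3 _ (List.get_mem _ i), k3]

lemma two_nsmul_row_zero (a : ℕ) : 2 • (genMatrix₈ a).row 0 = 0 := by
  simpa using (annihilates_genMatrix₈ a).nsmul_row 0

lemma eight_nsmul_eq_zero {α₁ α₂ α₃ : ℕ} (u : MixedSpace α₁ α₂ α₃) : 8 • u = 0 := by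
  have k1 : ∀ x : ZMod 2, 8 • x = 0 := by decide
  have k2 : ∀ x : ZMod 4, 8 • x = 0 := by decide
  have k3 : ∀ x : ZMod 8, 8 • x = 0 := by decide
  exact Prod.ext (funext fun i => k1 _) (Prod.ext (funext fun i => k2 _) (funext fun i => k3 _))

/-- The coefficients other than the first only matter modulo `8` in a combination of the rows of
`A^{a+1,0,1}`. -/
lemma comb_eq_of_dvd (a : ℕ) (k : Fin (a + 2) → ℤ) (hk : ∀ i : Fin (a + 1), 8 ∣ k i.succ) :
    (genMatrix₈ a).comb k = k 0 • (genMatrix₈ a).row 0 := by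
  change ∑ i : Fin (a + 1 + 1), k i • (genMatrix₈ a).row i = _
  rw [Fin.sum_univ_succ, add_eq_left]
  refine Finset.sum_eq_zero fun i _ => ?_
  obtain ⟨l, hl⟩ := hk i
  rw [hl, mul_comm, mul_smul]
  have := eight_nsmul_eq_zero ((genMatrix₈ a).row i.succ)
  rw [← natCast_zsmul] at this
  rw [show ((8 : ℤ)) = ((8 : ℕ) : ℤ) from rfl, this, smul_zero]

lemma even_zsmul_row_zero (a : ℕ) {x : ℤ} (hx : 2 ∣ x) : x • (genMatrix₈ a).row 0 = 0 := by
  obtain ⟨l, rfl⟩ := hx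
  have := two_nsmul_row_zero a
  rw [← natCast_zsmul] at this
  rw [mul_comm, mul_smul, show ((2 : ℤ)) = ((2 : ℕ) : ℤ) from rfl, this, smul_zero]

lemma nonempty_frame (a : ℕ) : Nonempty (Frame (a + 1) (genMatrix₈ a).additiveCode) := by
  obtain ⟨o, ho⟩ := List.mem_iff_get.1
    (mem_cols₁ a (Fin.cons (α := fun _ => ZMod 2) 1 0) rfl)
  have he₄ : ∀ i, ∃ c, (genMatrix₈ a).cols₂.get c =
      (Fin.cons (α := fun _ => ZMod 4) 2 (Pi.single i 1)) := fun i =>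
    exists_get_cols₂ a _ i (Pi.single_eq_same i _) fun j hj => Or.inl (Pi.single_eq_of_ne hj.ne _)
  have he₈ : ∀ i, ∃ c, (genMatrix₈ a).cols₃.get c =
      (Fin.cons (α := fun _ => ZMod 8) 4 (Pi.single i 1)) := fun i =>
    exists_get_cols₃ a _ i (Pi.single_eq_same i _) fun j hj => Or.inl (Pi.single_eq_of_ne hj.ne _)
  have hs₄ : ∀ i j, ∃ c, i ≠ j → (genMatrix₈ a).cols₂.get c =
      (Fin.cons (α := fun _ => ZMod 4) 2 (Pi.single i 1 + Pi.single j 1)) := by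
    intro i j
    by_cases hij : i = j
    · exact ⟨(he₄ i).choose, fun h => absurd hij h⟩
    · obtain ⟨f, hf, hlt⟩ := exists_first_single_add (R := ZMod 4) hij
      obtain ⟨c, hc⟩ := exists_get_cols₂ a _ f hf fun j hj => Or.inl (hlt j hj)
      exact ⟨c, fun _ => hc⟩
  have hs₈ : ∀ i j, ∃ c, i ≠ j → (genMatrix₈ a).cols₃.get c =
      (Fin.cons (α := fun _ => ZMod 8) 4 (Pi.single i 1 + Pi.single j 1)) := by
    intro i j
    by_cases hij : i = j
    · exact ⟨(he₈ i).choose, fun h => absurd hij h⟩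
    · obtain ⟨f, hf, hlt⟩ := exists_first_single_add (R := ZMod 8) hij
      obtain ⟨c, hc⟩ := exists_get_cols₃ a _ f hf fun j hj => Or.inl (hlt j hj)
      exact ⟨c, fun _ => hc⟩
  have hd₈ : ∀ i j, ∃ c, i ≠ j → (genMatrix₈ a).cols₃.get c =
      (Fin.cons (α := fun _ => ZMod 8) 4 (Pi.single j 1 + Pi.single i 2)) := by
    intro i j
    by_cases hij : i = j
    · exact ⟨(he₈ i).choose, fun h => absurd hij h⟩
    · obtain ⟨c, hc⟩ := exists_get_cols₃ a (Pi.single j 1 + Pi.single i 2) j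
        (by rw [Pi.add_apply, Pi.single_eq_same, Pi.single_eq_of_ne (Ne.symm hij), add_zero])
        fun k hk => by
          rw [Pi.add_apply, Pi.single_eq_of_ne hk.ne, zero_add]
          by_cases hki : k = i
          · subst hki; exact Or.inr (Pi.single_eq_same k _)
          · exact Or.inl (Pi.single_eq_of_ne hki _)
      exact ⟨c, fun _ => hc⟩
  choose e₄ he₄ using he₄
  choose e₈ he₈ using he₈
  choose s₄ hs₄ using hs₄
  choose s₈ hs₈ using hs₈
  choose d₈ hd₈ using hd₈
  let A := genMatrix₈ a
  have vo : ∀ k, (A.comb k).1 o = k 0 := by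
    intro k
    rw [A.comb_fst, ho]
    refine (sum_mul_cons (fun i => (k i : ZMod 2)) 1 0).trans ?_
    simp
  have ve₄ : ∀ k i, (A.comb k).2.1 (e₄ i) = (k 0 : ZMod 4) * 2 + (k i.succ : ℤ) := by
    intro k i
    rw [A.comb_snd_fst, he₄]
    refine (sum_mul_cons (fun i => (k i : ZMod 4)) 2 _).trans ?_
    simp [Pi.single_apply]
  have ve₈ : ∀ k i, (A.comb k).2.2 (e₈ i) = (k 0 : ZMod 8) * 4 + (k i.succ : ℤ) := by
    intro k i
    rw [A.comb_snd_snd, he₈]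
    refine (sum_mul_cons (fun i => (k i : ZMod 8)) 4 _).trans ?_
    simp [Pi.single_apply]
  have vs₄ : ∀ k i j, i ≠ j →
      (A.comb k).2.1 (s₄ i j) = (k 0 : ZMod 4) * 2 + (k i.succ + k j.succ : ℤ) := by
    intro k i j hij
    rw [A.comb_snd_fst, hs₄ i j hij]
    refine (sum_mul_cons (fun i => (k i : ZMod 4)) 2 _).trans ?_
    simp [Pi.single_apply, mul_add, Finset.sum_add_distrib]
  have vs₈ : ∀ k i j, i ≠ j →
      (A.comb k).2.2 (s₈ i j) = (k 0 : ZMod 8) * 4 + (k i.succ + k j.succ : ℤ) := by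
    intro k i j hij
    rw [A.comb_snd_snd, hs₈ i j hij]
    refine (sum_mul_cons (fun i => (k i : ZMod 8)) 4 _).trans ?_
    simp [Pi.single_apply, mul_add, Finset.sum_add_distrib]
  have vd₈ : ∀ k i j, i ≠ j →
      (A.comb k).2.2 (d₈ i j) = (k 0 : ZMod 8) * 4 + (k j.succ : ℤ) + (k i.succ : ℤ) * 2 := by
    intro k i j hij
    rw [A.comb_snd_snd, hd₈ i j hij]
    refine (sum_mul_cons (fun i => (k i : ZMod 8)) 4 _).trans ?_
    simp [Pi.single_apply, mul_add, Finset.sum_add_distrib, add_assoc]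
  have heq_zero : ∀ u ∈ A.additiveCode, u.1 o = 0 → (∀ i, u.2.2 (e₈ i) = 0) → u = 0 := by
    intro u hu h0 h8
    obtain ⟨k, rfl⟩ := A.exists_comb hu
    rw [vo] at h0
    have h2 : (2 : ℤ) ∣ k 0 := by
      have := (ZMod.intCast_zmod_eq_zero_iff_dvd (k 0) 2).1 h0
      exact_mod_cast this
    have hk : ∀ i : Fin (a + 1), 8 ∣ k i.succ := by
      intro i
      have h := h8 i
      rw [ve₈, ← quad_intCast, h0, show quad 0 = 0 by decide, zero_add] at h
      have := (ZMod.intCast_zmod_eq_zero_iff_dvd (k i.succ) 8).1 h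
      exact_mod_cast this
    rw [comb_eq_of_dvd a k hk, even_zsmul_row_zero a h2]
  have hrow : (genMatrix₈ a).row 0 = A.comb (Pi.single 0 1) := by
    rw [MixedMatrix.comb, Finset.sum_eq_single 0]
    · simp [A]
    · intro i _ hi
      rw [Pi.single_eq_of_ne hi, zero_smul]
    · simp
  refine ⟨⟨o, e₄, s₄, e₈, s₈, d₈, ?_, ?_, ?_, ?_, heq_zero, ?_, ?_⟩⟩
  · intro u hu i j hij
    obtain ⟨k, rfl⟩ := A.exists_comb hu
    rw [vs₈ k i j hij, ve₈, ve₈, vo, ← quad_intCast]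
    push_cast
    linear_combination -quad_add_self (k 0 : ZMod 2)
  · intro u hu i j hij
    obtain ⟨k, rfl⟩ := A.exists_comb hu
    rw [vd₈ k i j hij, ve₈, ve₈]
    have h8 : (8 : ZMod 8) = 0 := by decide
    linear_combination -(k 0 : ZMod 8) * h8
  · intro u hu i
    obtain ⟨k, rfl⟩ := A.exists_comb hu
    rw [ve₄, ve₈, vo]
    exact zbit_reduction _ _
  · intro u hu i j hij
    obtain ⟨k, rfl⟩ := A.exists_comb hu
    rw [vs₄ k i j hij, vs₈ k i j hij, vo]
    exact zbit_reduction _ _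
  · intro ε ν
    refine ⟨A.comb (Fin.cons (α := fun _ => ℤ) ε.val fun i => ((ν i - quad ε).val : ℤ)),
      A.comb_mem _, ?_, fun i => ?_⟩
    · rw [vo, Fin.cons_zero]
      simp
    · rw [ve₈, Fin.cons_zero, Fin.cons_succ]
      have : ((ε.val : ℤ) : ZMod 8) * 4 = quad ε := by rw [quad]; push_cast; ring
      rw [this]
      simp
  · intro u hu h1 h8
    rw [← mixedGray_row_zero a]
    congr 1
    rw [← sub_eq_zero]
    refine heq_zero _ (A.additiveCode.sub_mem hu (AddSubgroup.subset_closure ⟨0, rfl⟩)) ?_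
      fun i => ?_
    · change u.1 o - ((genMatrix₈ a).row 0).1 o = 0
      rw [h1, hrow, vo, Pi.single_eq_same]; decide
    · change u.2.2 (e₈ i) - ((genMatrix₈ a).row 0).2.2 (e₈ i) = 0
      rw [h8, hrow, ve₈, Pi.single_eq_same, Pi.single_eq_of_ne (Fin.succ_ne_zero i)]
      decide

/-! ### Correlations of the words of `H^{m,0,1}` -/

/-- The entry `∑ i, k i * c i` in column `c` of the combination of rows with coefficients `k`. -/
def colEntry {r : ℕ} {R : Type} [CommRing R] (k : Fin r → ℤ) (c : Fin r → R) : R :=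
  ∑ i, (k i : R) * c i

lemma colEntry_snoc {r : ℕ} {R : Type} [CommRing R] (k : Fin (r + 1) → ℤ) (c : Fin r → R) (x : R) :
    colEntry k (Fin.snoc (α := fun _ => R) c x) =
      colEntry (Fin.init k) c + (k (Fin.last r) : R) * x := by
  rw [colEntry, Fin.sum_univ_castSucc]
  simp [colEntry, Fin.init]

lemma sum_map_appendRow {r : ℕ} {R : Type} [CommRing R] (g : R → ℤ) (k : Fin (r + 1) → ℤ) (x : R)
    (L : List (Fin r → R)) : ((appendRow x L).map fun c => g (colEntry k c)).sum =
      (L.map fun c => g (colEntry (Fin.init k) c + (k (Fin.last r) : R) * x)).sum := by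
  rw [appendRow, List.map_map]
  congr 1
  refine List.map_congr_left fun c _ => ?_
  simp only [Function.comp_apply, colEntry_snoc]

lemma colEntry_add_single {r : ℕ} {R : Type} [CommRing R] (k : Fin r → ℤ) (z : Fin r → R)
    (i : Fin r) (t : R) : colEntry k (z + Pi.single i t) = colEntry k z + (k i : R) * t := by
  simp [colEntry, mul_add, Finset.sum_add_distrib, Pi.single_apply]

/-- The coefficients other than the first are divisible by `q`. -/
def TailDvd {r : ℕ} (q : ℤ) (k : Fin (r + 1) → ℤ) : Prop := ∀ i, i ≠ 0 → q ∣ k i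

lemma tailDvd_iff_init {r : ℕ} (q : ℤ) (k : Fin (r + 2) → ℤ) :
    TailDvd q k ↔ TailDvd q (Fin.init k : Fin (r + 1) → ℤ) ∧ q ∣ k (Fin.last (r + 1)) := by
  constructor
  · exact fun h => ⟨fun i hi => h i.castSucc (Fin.castSucc_ne_zero_iff.2 hi),
      h _ (Fin.last_pos.ne')⟩
  · rintro ⟨h1, h2⟩ i hi
    induction i using Fin.lastCases with
    | last => exact h2
    | cast i => exact h1 i (Fin.castSucc_ne_zero_iff.1 hi)

open Classical in
/-- The correlations over the additional quaternary columns cancel unless all coefficients are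
even: otherwise adding `2` in a suitable entry changes all signs. -/
lemma sum_newCols₄ {r : ℕ} (k : Fin (r + 1) → ℤ) (x : ZMod 4) :
    ((newCols₄ (r + 1)).map fun z => corr₄ (colEntry k z + x)).sum =
      if TailDvd 2 k then 2 ^ r * corr₄ ((k 0 : ZMod 4) * 2 + x) else 0 := by
  split_ifs with h
  · have hconst : ∀ z ∈ newCols₄ (r + 1), corr₄ (colEntry k z + x) =
        corr₄ ((k 0 : ZMod 4) * 2 + x) := by
      intro z hz
      rw [mem_newCols₄] at hz
      have : colEntry k z = (k 0 : ZMod 4) * 2 := by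
        rw [colEntry, Fin.sum_univ_succ, show z 0 = 2 from hz 0, add_eq_left]
        refine Finset.sum_eq_zero fun i _ => ?_
        obtain ⟨l, hl⟩ := h i.succ (Fin.succ_ne_zero i)
        have h1 : z i.succ = 0 ∨ z i.succ = 2 := by simpa using hz i.succ
        have key : ∀ l : ZMod 4, 2 * l * 2 = 0 := by decide
        rw [hl]
        push_cast
        rcases h1 with h1 | h1 <;> rw [h1]
        · rw [mul_zero]
        · exact key _
      rw [this]
    rw [List.map_congr_left hconst, List.map_const', List.sum_replicate, length_newCols₄]
    simp
  · simp only [TailDvd, not_forall] at h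
    obtain ⟨i, hi, hk⟩ := h
    have hk2 : (k i : ZMod 4) * 2 = 2 := by
      have key : ∀ x : ZMod 4, (x.cast : ZMod 2) ≠ 0 → x * 2 = 2 := by decide
      refine key _ ?_
      rw [ZMod.cast_intCast (by norm_num)]
      intro h0
      exact hk (by exact_mod_cast (ZMod.intCast_zmod_eq_zero_iff_dvd (k i) 2).1 h0)
    have hneg : ∀ u : ZMod 4, corr₄ (u + 2) = -corr₄ u := by decide
    have hsum : ∑ z ∈ (newCols₄ (r + 1)).toFinset, corr₄ (colEntry k z + x) =
        ∑ z ∈ (newCols₄ (r + 1)).toFinset, -corr₄ (colEntry k z + x) := by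
      symm
      refine Finset.sum_equiv (Equiv.addRight (Pi.single i 2)) (fun z => ?_) fun z _ => ?_
      · simp only [List.mem_toFinset, mem_newCols₄, Equiv.coe_addRight, Pi.add_apply]
        refine forall_congr' fun j => ?_
        by_cases hj : j = i
        · subst hj
          have hj0 : j.val ≠ 0 := fun h => hi (Fin.ext h)
          rw [if_neg hj0, if_neg hj0, Pi.single_eq_same]
          have key : ∀ u : ZMod 4, (u = 0 ∨ u = 2) ↔ (u + 2 = 0 ∨ u + 2 = 2) := by decide
          exact key _
        · rw [Pi.single_eq_of_ne hj, add_zero]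
      · rw [Equiv.coe_addRight, colEntry_add_single, hk2, add_right_comm, hneg]
    rw [Finset.sum_neg_distrib, newCols₄, Finset.toList_toFinset] at hsum
    rw [newCols₄, Finset.sum_map_toList]
    linarith

open Classical in
/-- The correlations over the additional octal columns cancel unless all coefficients are divisible
by four: otherwise adding `2` or `4` in a suitable entry changes all signs. -/
lemma sum_newCols₈ {r : ℕ} (k : Fin (r + 1) → ℤ) (x : ZMod 8) :
    ((newCols₈ (r + 1)).map fun z => corr₈ (colEntry k z + x)).sum =
      if TailDvd 4 k then 4 ^ r * corr₈ ((k 0 : ZMod 8) * 4 + x) else 0 := by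
  split_ifs with h
  · have hconst : ∀ z ∈ newCols₈ (r + 1), corr₈ (colEntry k z + x) =
        corr₈ ((k 0 : ZMod 8) * 4 + x) := by
      intro z hz
      rw [mem_newCols₈] at hz
      have : colEntry k z = (k 0 : ZMod 8) * 4 := by
        rw [colEntry, Fin.sum_univ_succ, show z 0 = 4 from hz 0, add_eq_left]
        refine Finset.sum_eq_zero fun i _ => ?_
        obtain ⟨l, hl⟩ := h i.succ (Fin.succ_ne_zero i)
        have h1 : z i.succ = 0 ∨ z i.succ = 2 ∨ z i.succ = 4 ∨ z i.succ = 6 := by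
          simpa using hz i.succ
        have key : ∀ l u : ZMod 8, (u = 0 ∨ u = 2 ∨ u = 4 ∨ u = 6) → 4 * l * u = 0 := by decide
        rw [hl]
        push_cast
        exact key _ _ h1
      rw [this]
    rw [List.map_congr_left hconst, List.map_const', List.sum_replicate, length_newCols₈]
    simp
  · simp only [TailDvd, not_forall] at h
    obtain ⟨i, hi, hk⟩ := h
    obtain ⟨t, ht, hkt⟩ : ∃ t : ZMod 8, (t = 2 ∨ t = 4) ∧ (k i : ZMod 8) * t = 4 := by
      have key : ∀ x : ZMod 8, (x.cast : ZMod 4) ≠ 0 → ∃ t, (t = 2 ∨ t = 4) ∧ x * t = 4 := by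
        decide
      refine key _ ?_
      rw [ZMod.cast_intCast (by norm_num)]
      intro h0
      exact hk (by exact_mod_cast (ZMod.intCast_zmod_eq_zero_iff_dvd (k i) 4).1 h0)
    have hneg : ∀ u : ZMod 8, corr₈ (u + 4) = -corr₈ u := by decide
    have hsum : ∑ z ∈ (newCols₈ (r + 1)).toFinset, corr₈ (colEntry k z + x) =
        ∑ z ∈ (newCols₈ (r + 1)).toFinset, -corr₈ (colEntry k z + x) := by
      symm
      refine Finset.sum_equiv (Equiv.addRight (Pi.single i t)) (fun z => ?_) fun z _ => ?_
      · simp only [List.mem_toFinset, mem_newCols₈, Equiv.coe_addRight, Pi.add_apply]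
        refine forall_congr' fun j => ?_
        by_cases hj : j = i
        · subst hj
          have hj0 : j.val ≠ 0 := fun h => hi (Fin.ext h)
          rw [if_neg hj0, if_neg hj0, Pi.single_eq_same]
          have key : ∀ u t : ZMod 8, (t = 2 ∨ t = 4) → ((u = 0 ∨ u = 2 ∨ u = 4 ∨ u = 6) ↔
              (u + t = 0 ∨ u + t = 2 ∨ u + t = 4 ∨ u + t = 6)) := by decide
          exact key _ _ ht
        · rw [Pi.single_eq_of_ne hj, add_zero]
      · rw [Equiv.coe_addRight, colEntry_add_single, hkt, add_right_comm, hneg]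
    rw [Finset.sum_neg_distrib, newCols₈, Finset.toList_toFinset] at hsum
    rw [newCols₈, Finset.sum_map_toList]
    linarith

namespace MixedMatrix

variable {r : ℕ} (A : MixedMatrix r) (k : Fin r → ℤ)

/-- The contribution of the binary columns to the correlation of `A.comb k`. -/
def corrSum₁ : ℤ := (A.cols₁.map fun c => corr₂ (colEntry k c)).sum

/-- The contribution of the quaternary columns to the correlation of `A.comb k`. -/
def corrSum₂ : ℤ := (A.cols₂.map fun c => corr₄ (colEntry k c)).sum

/-- The contribution of the octal columns to the correlation of `A.comb k`. -/
def corrSum₃ : ℤ := (A.cols₃.map fun c => corr₈ (colEntry k c)).sum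

lemma mixedCorr_comb : mixedCorr (A.comb k) = A.corrSum₁ k + A.corrSum₂ k + A.corrSum₃ k := by
  simp only [mixedCorr, comb_fst, comb_snd_fst, comb_snd_snd]
  congr 1
  · congr 1
    · exact Fin.sum_univ_fun_getElem A.cols₁ fun c => corr₂ (colEntry k c)
    · exact Fin.sum_univ_fun_getElem A.cols₂ fun c => corr₄ (colEntry k c)
  · exact Fin.sum_univ_fun_getElem A.cols₃ fun c => corr₈ (colEntry k c)

end MixedMatrix

section Step

variable {r : ℕ} (A : MixedMatrix (r + 1)) (k : Fin (r + 2) → ℤ)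

lemma corrSum₁_addRow₈ : (addRow₈ A).corrSum₁ k =
    if 2 ∣ k (Fin.last (r + 1)) then 2 * A.corrSum₁ (Fin.init k) else 0 := by
  have key : ∀ u x : ZMod 2, corr₂ (u + x * 0) + corr₂ (u + x * 1) =
      if x = 0 then 2 * corr₂ u else 0 := by decide
  have hiff : (k (Fin.last (r + 1)) : ZMod 2) = 0 ↔ 2 ∣ k (Fin.last (r + 1)) := by
    exact_mod_cast ZMod.intCast_zmod_eq_zero_iff_dvd _ 2
  rw [MixedMatrix.corrSum₁, addRow₈, List.map_append, List.sum_append, sum_map_appendRow,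
    sum_map_appendRow, ← List.sum_map_add]
  simp only [key, hiff]
  split_ifs
  · rw [List.sum_map_mul_left]; rfl
  · simp

open Classical in
lemma corrSum₂_addRow₈ : (addRow₈ A).corrSum₂ k =
    (if TailDvd 2 (Fin.init k : Fin (r + 1) → ℤ) then
      2 ^ r * corr₄ ((k 0 : ZMod 4) * 2 + (k (Fin.last (r + 1)) : ZMod 4)) else 0) +
    if 4 ∣ k (Fin.last (r + 1)) then 4 * A.corrSum₂ (Fin.init k) else 0 := by
  have key : ∀ u x : ZMod 4, corr₄ (u + x * 0) + (corr₄ (u + x * 1) +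
      (corr₄ (u + x * 2) + corr₄ (u + x * 3))) = if x = 0 then 4 * corr₄ u else 0 := by decide
  have hiff : (k (Fin.last (r + 1)) : ZMod 4) = 0 ↔ 4 ∣ k (Fin.last (r + 1)) := by
    exact_mod_cast ZMod.intCast_zmod_eq_zero_iff_dvd _ 4
  rw [MixedMatrix.corrSum₂, addRow₈, List.map_append, List.sum_append, sum_map_appendRow,
    mul_one, sum_newCols₄]
  congr 1
  simp only [List.flatMap_cons, List.flatMap_nil, List.append_nil, List.map_append,
    List.sum_append, sum_map_appendRow]
  simp only [← List.sum_map_add, key, hiff]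
  split_ifs
  · rw [List.sum_map_mul_left]; rfl
  · simp

open Classical in
lemma corrSum₃_addRow₈ : (addRow₈ A).corrSum₃ k =
    (if TailDvd 4 (Fin.init k : Fin (r + 1) → ℤ) then
      4 ^ r * corr₈ ((k 0 : ZMod 8) * 4 + (k (Fin.last (r + 1)) : ZMod 8)) else 0) +
    if 8 ∣ k (Fin.last (r + 1)) then 8 * A.corrSum₃ (Fin.init k) else 0 := by
  have key : ∀ u x : ZMod 8, corr₈ (u + x * 0) + (corr₈ (u + x * 1) + (corr₈ (u + x * 2) +
      (corr₈ (u + x * 3) + (corr₈ (u + x * 4) + (corr₈ (u + x * 5) + (corr₈ (u + x * 6) +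
      corr₈ (u + x * 7))))))) = if x = 0 then 8 * corr₈ u else 0 := by decide
  have hiff : (k (Fin.last (r + 1)) : ZMod 8) = 0 ↔ 8 ∣ k (Fin.last (r + 1)) := by
    exact_mod_cast ZMod.intCast_zmod_eq_zero_iff_dvd _ 8
  rw [MixedMatrix.corrSum₃, addRow₈, List.map_append, List.sum_append, sum_map_appendRow,
    mul_one, sum_newCols₈]
  congr 1
  simp only [List.flatMap_cons, List.flatMap_nil, List.append_nil, List.map_append,
    List.sum_append, sum_map_appendRow]
  simp only [← List.sum_map_add, key, hiff]
  split_ifs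
  · rw [List.sum_map_mul_left]; rfl
  · simp

end Step

lemma corr₄_entry (x y : ℤ) : corr₄ ((x : ZMod 4) * 2 + (y : ZMod 4)) =
    if 4 ∣ y then 2 * corr₂ x else if 2 ∣ y then -2 * corr₂ x else 0 := by
  have key : ∀ x y : ZMod 4, corr₄ (x * 2 + y) = if y = 0 then 2 * corr₂ (x.cast : ZMod 2)
      else if (y.cast : ZMod 2) = 0 then -2 * corr₂ (x.cast : ZMod 2) else 0 := by decide
  have := key x y
  rw [ZMod.cast_intCast (by norm_num), ZMod.cast_intCast (by norm_num)] at this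
  rw [this]
  have h4 : (y : ZMod 4) = 0 ↔ 4 ∣ y := by exact_mod_cast ZMod.intCast_zmod_eq_zero_iff_dvd y 4
  have h2 : (y : ZMod 2) = 0 ↔ 2 ∣ y := by exact_mod_cast ZMod.intCast_zmod_eq_zero_iff_dvd y 2
  simp only [h4, h2]

lemma corr₈_entry (x y : ℤ) : corr₈ ((x : ZMod 8) * 4 + (y : ZMod 8)) =
    if 8 ∣ y then 4 * corr₂ x else if 4 ∣ y then -4 * corr₂ x else 0 := by
  have key : ∀ x y : ZMod 8, corr₈ (x * 4 + y) = if y = 0 then 4 * corr₂ (x.cast : ZMod 2)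
      else if (y.cast : ZMod 4) = 0 then -4 * corr₂ (x.cast : ZMod 2) else 0 := by decide
  have := key x y
  rw [ZMod.cast_intCast (by norm_num), ZMod.cast_intCast (by norm_num)] at this
  rw [this]
  have h8 : (y : ZMod 8) = 0 ↔ 8 ∣ y := by exact_mod_cast ZMod.intCast_zmod_eq_zero_iff_dvd y 8
  have h4 : (y : ZMod 4) = 0 ↔ 4 ∣ y := by exact_mod_cast ZMod.intCast_zmod_eq_zero_iff_dvd y 4
  simp only [h8, h4]

open Classical in
/-- The three partial correlation sums of a word of `H^{a+1,0,1}`. They are the sums of the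
characters of `ℤ₂^{a+1}`, `ℤ₄^{a+1}` and `ℤ₈^{a+1}` that are given by the coefficients other
than the first, up to the sign given by the first coefficient. -/
lemma corrSum_genMatrix₈ (a : ℕ) (k : Fin (a + 2) → ℤ) :
    (genMatrix₈ a).corrSum₁ k = (if TailDvd 2 k then 2 ^ (a + 1) * corr₂ (k 0) else 0) ∧
    (genMatrix₈ a).corrSum₁ k + (genMatrix₈ a).corrSum₂ k =
      (if TailDvd 4 k then 4 ^ (a + 1) * corr₂ (k 0) else 0) ∧
    (genMatrix₈ a).corrSum₁ k + (genMatrix₈ a).corrSum₂ k + (genMatrix₈ a).corrSum₃ k =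
      (if TailDvd 8 k then 8 ^ (a + 1) * corr₂ (k 0) else 0) := by
  induction a with
  | zero =>
    have ht : ∀ q, TailDvd q k ↔ q ∣ k 1 := fun q =>
      ⟨fun h => h 1 (by decide), fun h i hi => by
        have key : ∀ i : Fin 2, i ≠ 0 → i = 1 := by decide
        rw [key i hi]; exact h⟩
    have h1 : (genMatrix₈ 0).corrSum₁ k = if 2 ∣ k 1 then 2 * corr₂ (k 0) else 0 := by
      have key : ∀ x y : ZMod 2, corr₂ x + corr₂ (x + y) = if y = 0 then 2 * corr₂ x else 0 := by
        decide
      have hiff : (k 1 : ZMod 2) = 0 ↔ 2 ∣ k 1 := by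
        exact_mod_cast ZMod.intCast_zmod_eq_zero_iff_dvd _ 2
      simp [MixedMatrix.corrSum₁, genMatrix₈, baseMatrix, colEntry, key, hiff]
    have h2 : (genMatrix₈ 0).corrSum₂ k = corr₄ ((k 0 : ZMod 4) * 2 + (k 1 : ZMod 4)) := by
      simp [MixedMatrix.corrSum₂, genMatrix₈, baseMatrix, colEntry]
    have h3 : (genMatrix₈ 0).corrSum₃ k = corr₈ ((k 0 : ZMod 8) * 4 + (k 1 : ZMod 8)) := by
      simp [MixedMatrix.corrSum₃, genMatrix₈, baseMatrix, colEntry]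
    rw [h1, h2, h3, ht, ht, ht, corr₄_entry, corr₈_entry]
    refine ⟨?_, ?_, ?_⟩ <;> split_ifs <;> omega
  | succ a ih =>
    obtain ⟨h1, h2, h3⟩ := ih (Fin.init k)
    have hk0 : (Fin.init k : Fin (a + 2) → ℤ) 0 = k 0 := rfl
    rw [hk0] at h1 h2 h3
    have e1 := corrSum₁_addRow₈ (genMatrix₈ a) k
    have e2 := corrSum₂_addRow₈ (genMatrix₈ a) k
    have e3 := corrSum₃_addRow₈ (genMatrix₈ a) k
    have td : ∀ q, TailDvd q k ↔
        TailDvd q (Fin.init k : Fin (a + 2) → ℤ) ∧ q ∣ k (Fin.last (a + 2)) :=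
      fun q => tailDvd_iff_init q k
    rw [show Fin.last (a + 1 + 1) = Fin.last (a + 2) from rfl] at e1 e2 e3
    have t1 : (if TailDvd 2 (Fin.init k : Fin (a + 2) → ℤ) then
        2 ^ (a + 1) * corr₄ ((k 0 : ZMod 4) * 2 + (k (Fin.last (a + 2)) : ZMod 4)) else 0) =
        if 4 ∣ k (Fin.last (a + 2)) then 2 * (genMatrix₈ a).corrSum₁ (Fin.init k) else
          if 2 ∣ k (Fin.last (a + 2)) then -2 * (genMatrix₈ a).corrSum₁ (Fin.init k) else 0 := by
      rw [corr₄_entry, h1]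
      split_ifs <;> ring
    have t2 : (if TailDvd 4 (Fin.init k : Fin (a + 2) → ℤ) then
        4 ^ (a + 1) * corr₈ ((k 0 : ZMod 8) * 4 + (k (Fin.last (a + 2)) : ZMod 8)) else 0) =
        if 8 ∣ k (Fin.last (a + 2)) then 4 * ((genMatrix₈ a).corrSum₁ (Fin.init k) +
            (genMatrix₈ a).corrSum₂ (Fin.init k)) else
          if 4 ∣ k (Fin.last (a + 2)) then -4 * ((genMatrix₈ a).corrSum₁ (Fin.init k) +
            (genMatrix₈ a).corrSum₂ (Fin.init k)) else 0 := by
      rw [corr₈_entry, h2]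
      split_ifs <;> ring
    rw [t1] at e2
    rw [t2] at e3
    clear t1 t2
    rw [td, td, td]
    clear td
    generalize k (Fin.last (a + 2)) = x at e1 e2 e3 ⊢
    have f2 : (genMatrix₈ (a + 1)).corrSum₁ k + (genMatrix₈ (a + 1)).corrSum₂ k =
        if 4 ∣ x then 4 * ((genMatrix₈ a).corrSum₁ (Fin.init k) +
            (genMatrix₈ a).corrSum₂ (Fin.init k)) else 0 := by
      rw [genMatrix₈, e1, e2]
      split_ifs <;> omega
    have f3 : (genMatrix₈ (a + 1)).corrSum₁ k + (genMatrix₈ (a + 1)).corrSum₂ k +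
        (genMatrix₈ (a + 1)).corrSum₃ k =
        if 8 ∣ x then 8 * ((genMatrix₈ a).corrSum₁ (Fin.init k) +
            (genMatrix₈ a).corrSum₂ (Fin.init k) + (genMatrix₈ a).corrSum₃ (Fin.init k))
          else 0 := by
      rw [f2, genMatrix₈, e3]
      split_ifs <;> omega
    refine ⟨?_, ?_, ?_⟩
    · rw [genMatrix₈, e1, h1]
      split_ifs <;> first | ring1 | tauto
    · rw [f2, h2]
      split_ifs <;> first | ring1 | tauto
    · rw [f3, h3]
      split_ifs <;> first | ring1 | tauto

/-- Two distinct words of `H^{a+1,0,1}` are complementary or differ in half of the coordinates. -/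
lemma mixedGray_dist (a : ℕ) {u v : (genMatrix₈ a).Space} (hu : u ∈ (genMatrix₈ a).additiveCode)
    (hv : v ∈ (genMatrix₈ a).additiveCode) (huv : u ≠ v) :
    mixedGray u + mixedGray v = 1 ∨
      2 * hammingDist (mixedGray u) (mixedGray v) = Fintype.card (genMatrix₈ a).Coord := by
  obtain ⟨k, hk⟩ := (genMatrix₈ a).exists_comb ((genMatrix₈ a).additiveCode.sub_mem hu hv)
  by_cases h8 : TailDvd 8 k
  · left
    have h1 : u - v = k 0 • (genMatrix₈ a).row 0 := by
      rw [hk, comb_eq_of_dvd a k fun i => h8 i.succ (Fin.succ_ne_zero i)]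
    rcases Int.even_or_odd' (k 0) with ⟨l, hl | hl⟩
    · rw [even_zsmul_row_zero a ⟨l, hl⟩] at h1
      exact absurd (sub_eq_zero.1 h1) huv
    · rw [hl, add_smul, even_zsmul_row_zero a ⟨l, rfl⟩, zero_add, one_smul] at h1
      have h2 := mixedGray_add _ v (two_nsmul_row_zero a)
      rw [← h1, sub_add_cancel, h1, mixedGray_row_zero] at h2
      rw [← h2, add_assoc, word_add_self, add_zero]
  · right
    have h1 := two_mul_hammingDist_mixedGray u v
    rw [hk, MixedMatrix.mixedCorr_comb, (corrSum_genMatrix₈ a k).2.2, if_neg h8, sub_zero] at h1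
    exact_mod_cast h1

lemma card_coord_genMatrix₈ (a : ℕ) : Fintype.card (genMatrix₈ a).Coord = 8 ^ (a + 1) := by
  rw [card_mixedCoord]
  exact (length_genMatrix₈ a).2.2

lemma isHadamardCode_genMatrix₈ (a : ℕ) :
    IsHadamardCode (mixedGray '' ((genMatrix₈ a).additiveCode : Set (genMatrix₈ a).Space)) := by
  obtain ⟨F⟩ := nonempty_frame a
  have h8 : 8 ^ (a + 1) = 2 * (4 * 8 ^ a) := by ring
  have hone : hammingDist (1 : (genMatrix₈ a).Coord → ZMod 2) 0 = 8 ^ (a + 1) := by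
    rw [hammingDist, ← card_coord_genMatrix₈]
    simp
  refine ⟨?_, 4 * 8 ^ a, ⟨?_, ?_⟩, ?_⟩
  · rw [Set.ncard_image_of_injective _ mixedGray_injective, card_coord_genMatrix₈]
    exact F.card_eq
  · obtain ⟨u, hu, h0, h1⟩ := F.exists_word 0 1
    have hz := gray_zero (mixedGray_add (α₁ := (genMatrix₈ a).cols₁.length)
      (α₂ := (genMatrix₈ a).cols₂.length) (α₃ := (genMatrix₈ a).cols₃.length))
    have hne : u ≠ 0 := by
      rintro rfl
      exact absurd (h1 0) (by change (0 : ZMod 8) ≠ 1; decide)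
    refine ⟨_, ⟨u, hu, rfl⟩, _, ⟨0, zero_mem _, rfl⟩, mixedGray_injective.ne hne, ?_⟩
    rcases mixedGray_dist a hu (zero_mem _) hne with h | h
    · rw [hz, add_zero] at h
      have h2 := congrFun h (.inl F.o)
      change u.1 F.o = 1 at h2
      rw [h0] at h2
      exact absurd h2 (by decide)
    · rw [card_coord_genMatrix₈] at h
      omega
  · rintro _ ⟨_, ⟨u, hu, rfl⟩, _, ⟨v, hv, rfl⟩, hne, rfl⟩
    rcases mixedGray_dist a hu hv (fun h => hne (congrArg _ h)) with h | h
    · have h2 : mixedGray v =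
          mixedGray u + (1 : (genMatrix₈ a).Coord → ZMod 2) ∘ (Equiv.refl _) := by
        rw [← h]
        funext p
        simp only [Pi.add_apply, Function.comp_apply, Equiv.refl_apply]
        rw [← add_assoc, CharTwo.add_self_eq_zero, zero_add]
      rw [h2, hammingDist_add_comp, hone]
      omega
    · rw [card_coord_genMatrix₈] at h
      omega
  · rw [card_coord_genMatrix₈, h8]

/-! ### Comparison with other linear Hadamard codes -/

theorem mainTheorem6 (t m : ℕ) (hm : 2 ≤ m) (ht : t = 3 * m) :
    -- `H^{t/3,0,1}` is a binary Hadamard code of length `2 ^ t`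
    (Fintype.card (HCoord (t / 3) 0 1) = 2 ^ t ∧ IsHadamardCode (HCode (t / 3) 0 1)) ∧
    -- it is not equivalent to any other `H^{t₁,t₂,t₃}` of length `2 ^ t`
    (∀ t₁ t₂ t₃ : ℕ, 1 ≤ t₁ → 1 ≤ t₃ → (t₁, t₂, t₃) ≠ (t / 3, 0, 1) →
      Fintype.card (HCoord t₁ t₂ t₃) = 2 ^ t →
        ¬ CodeEquivalent (HCode (t / 3) 0 1) (HCode t₁ t₂ t₃)) ∧
    -- nor to any `ℤ₂ℤ₄`-linear Hadamard code of length `2 ^ t`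
    (∀ (α₁ α₂ : ℕ) (C : AddSubgroup ((Fin α₁ → ZMod 2) × (Fin α₂ → ZMod 4))),
      α₁ + 2 * α₂ = 2 ^ t →
      IsHadamardCode (gray24 '' (C : Set ((Fin α₁ → ZMod 2) × (Fin α₂ → ZMod 4)))) →
        ¬ CodeEquivalent (HCode (t / 3) 0 1)
          (gray24 '' (C : Set ((Fin α₁ → ZMod 2) × (Fin α₂ → ZMod 4))))) ∧
    -- nor to any `ℤ₄`-linear Hadamard code of length `2 ^ t`
    (∀ (n : ℕ) (C : AddSubgroup (Fin n → ZMod 4)),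
      2 * n = 2 ^ t →
      IsHadamardCode (gray4 '' (C : Set (Fin n → ZMod 4))) →
        ¬ CodeEquivalent (HCode (t / 3) 0 1) (gray4 '' (C : Set (Fin n → ZMod 4)))) ∧
    -- nor to any `ℤ₈`-linear Hadamard code of length `2 ^ t`
    (∀ (n : ℕ) (C : AddSubgroup (Fin n → ZMod 8)),
      4 * n = 2 ^ t →
      IsHadamardCode (gray8 '' (C : Set (Fin n → ZMod 8))) →
        ¬ CodeEquivalent (HCode (t / 3) 0 1) (gray8 '' (C : Set (Fin n → ZMod 8)))) := by
  have hd : t / 3 = m := by omega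
  rw [hd]
  obtain ⟨a, rfl⟩ : ∃ a, m = a + 1 := ⟨m - 1, by omega⟩
  have h8 : 8 ^ (a + 1) = 2 ^ t := by rw [ht, pow_mul]; norm_num
  have hcode : HCode (a + 1) 0 1 =
    mixedGray '' ((genMatrix₈ a).additiveCode : Set (genMatrix₈ a).Space) := rfl
  obtain ⟨F⟩ := nonempty_frame a
  refine ⟨⟨(card_coord_genMatrix₈ a).trans h8, isHadamardCode_genMatrix₈ a⟩, ?_, ?_, ?_, ?_⟩
  · intro t₁ t₂ t₃ ht₁ ht₃ hne hlen h
    obtain ⟨a', rfl⟩ : ∃ a', t₁ = a' + 1 := ⟨t₁ - 1, by omega⟩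
    obtain ⟨c, rfl⟩ : ∃ c, t₃ = c + 1 := ⟨t₃ - 1, by omega⟩
    have hlen' : 3 * (a' + 1) + 2 * t₂ + c = t := by
      rw [card_mixedCoord] at hlen
      have h1 := (length_genMatrix₂ a' t₂ c).symm.trans hlen
      rw [show 8 = 2 ^ 3 by norm_num, show 4 = 2 ^ 2 by norm_num, ← pow_mul, ← pow_mul,
        ← pow_add, ← pow_add] at h1
      exact Nat.pow_right_injective le_rfl h1
    rw [hcode] at h
    obtain ⟨hcard, htors⟩ := F.card_of_codeEquivalent hm mixedGray_injective mixedGray_add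
      (genMatrix₂ a' t₂ c).additiveCode h
    have h2 := (card_le_card_twoTorsion_mul a' t₂ c).trans (Nat.mul_le_mul_right _ htors)
    rw [hcard, show 4 = 2 ^ 2 by norm_num, ← pow_mul, ← pow_add, ← pow_add,
      Nat.pow_le_pow_iff_right (by norm_num)] at h2
    refine hne ?_
    simp only [Prod.mk.injEq]
    omega
  · intro α₁ α₂ C _ _
    refine F.not_codeEquivalent_of_four_nsmul hm gray24_injective gray24_add C fun u _ => ?_
    have k₂ : ∀ x : ZMod 2, 4 • x = 0 := by decide
    have k₄ : ∀ x : ZMod 4, 4 • x = 0 := by decide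
    exact Prod.ext (funext fun i => k₂ (u.1 i)) (funext fun i => k₄ (u.2 i))
  · intro n C _ _
    refine F.not_codeEquivalent_of_four_nsmul hm gray4_injective gray4_add C fun u _ => ?_
    have k₄ : ∀ x : ZMod 4, 4 • x = 0 := by decide
    exact funext fun i => k₄ (u i)
  · intro n C _ _
    exact F.not_codeEquivalent_gray8 hm (card_coord_genMatrix₈ a)
      (fun u hu v hv huv => mixedGray_dist a hu hv huv) C
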